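/- **Theorem (General slice theorem).** Manifolds and Lie groups are smooth (in the sense of Michal–Bastiani) and modeled on real Hausdorff locally convex spaces, where the model space may vary from chart to chart; a submanifold is a subset which in suitable charts corresponds to a closed linear subspace. Let $G$ be a Lie group acting smoothly on a manifold $M$, and let the action be proper, i.e. preimages of compact sets under $G\times M\to M\times M$, $(g,p)\mapsto(g\cdot p,p)$, are compact. Let $m\in M$, with stabilizer $G_m$ and orbit $O=G\cdot m$. Assume: 1. $G_m$ is a principal Lie subgroup of $G$: it is a submanifold of $G$, and $G/G_m$ (with the quotient topology) is a manifold such that $G\to G/G_m$ is a smooth, locally trivial principal $G_m$-bundle. 2. $O$ is a locally closed submanifold of $M$, diffeomorphic to $G/G_m$ via $[g]\mapsto g\cdot m$, and its normal bundle is realized as a smooth $G$-invariant vector subbundle $NO\subseteq TM|_O$, i.e. $T_pM=T_pO\oplus N_pO$ topologically for all $p\in O$. 3. There is a $G$-equivariant local addition $\eta:TM\supseteq U\to M$ adapted to $O$. That is: $U$ is a $G$-invariant open neighborhood of the zero section, $\eta$ is smooth and $G$-equivariant, $\eta(p,0)=p$ for all $p\in M$, the map $X_p\mapsto(p,\eta(X_p))$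 is a diffeomorphism from $U$ onto an open neighborhood of the diagonal in $M\times M$, and the restriction of $\eta$ to $U\cap NO$ is a local diffeomorphism into $M$ at every point of the zero section of $NO$. 4. There are a $G$-invariant metric $d$ on $M$ which induces the topology of $M$ and a $G$-invariant fiber metric $\rho$ on $TM$, i.e. metrics $\rho_p$ on $T_pM$ inducing the topology of $T_pM$, with $\rho_{g\cdot p}(g\cdot X,g\cdot Y)=\rho_p(X,Y)$. Then there is $\varepsilon>0$ such that every $X\in N_mO$ with $\rho_m(X,0)<\varepsilon$ lies in $U$ and $$S=\{\eta(X)\;:\;X\in N_mO,\ \rho_m(X,0)<\varepsilon\}$$ is a linear slice at $m$. That is, $S$ is a submanifold of $M$ containing $m$ such that - $G_m\cdot S\subseteq S$; - if $g\cdot S\cap S\neq\emptyset$, then $g\in G_m$; - $G_m$ is a principal Lie subgroup of $G$, and there is a smooth section $\chi:W\to G$ of $G\to G/G_m$ on an open neighborhood $W$ of the identity coset such that $W\times S\to M$, $([g],s)\mapsto\chi([g])\cdot s$, is a diffeomorphism onto an open neighborhood of $m$; - $\{s\in S : G_s \text{ is conjugate to } G_m\}$ is a closed submanifold of $S$; -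 there are a continuous representation of $G_m$ on a locally convex space $X$ and a $G_m$-equivariant diffeomorphism $\iota$ from a $G_m$-invariant open neighborhood of $0$ in $X$ onto $S$ with $\iota(0)=m$. -/

import Mathlib

open Set Filter Topology

noncomputable section

set_option linter.unusedSectionVars false

namespace LC

universe u v w

section Calculus

/-- The difference quotients of `f` at `x` in the direction `v` converge to `l`. -/
def HasDirDeriv {E : Type u} {F : Type v} [AddCommGroup E] [Module ℝ E]
    [AddCommGroup F] [Module ℝ F] [TopologicalSpace F] (f : E → F) (x v : E) (l : F) : Prop :=
  Tendsto (fun t : ℝ => t⁻¹ • (f (x + t • v) - f x)) (𝓝[≠] 0) (𝓝 l)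

/-- The directional derivative `df(x)(v) = lim_{t → 0} (f (x + t v) - f x) / t`. -/
def dirDeriv {E : Type u} {F : Type v} [AddCommGroup E] [Module ℝ E]
    [AddCommGroup F] [Module ℝ F] [TopologicalSpace F] (f : E → F) (x v : E) : F :=
  limUnder (𝓝[≠] (0 : ℝ)) (fun t : ℝ => t⁻¹ • (f (x + t • v) - f x))

/-- `f` is of class `C^n` on the open set `U` in the sense of Michal and Bastiani: `f` is
continuous on `U`, all directional derivatives exist on `U`, and
`df : U × E → F, (x, v) ↦ df(x)(v)` is of class `C^(n-1)`. -/
def IsCn : ℕ → ∀ {E : Type u} {F : Type v} [AddCommGroup E] [Module ℝ E] [TopologicalSpace E]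
    [AddCommGroup F] [Module ℝ F] [TopologicalSpace F], (E → F) → Set E → Prop
  | 0, _, _, _, _, _, _, _, _, f, U => ContinuousOn f U
  | n + 1, _, _, _, _, _, _, _, _, f, U =>
      ContinuousOn f U ∧ (∀ x ∈ U, ∀ v, HasDirDeriv f x v (dirDeriv f x v)) ∧
        IsCn n (fun p => dirDeriv f p.1 p.2) (U ×ˢ univ)

/-- `f` is smooth (of class `C^n` for all `n`) on the open set `U`. -/
def IsSmooth {E : Type u} {F : Type v} [AddCommGroup E] [Module ℝ E] [TopologicalSpace E]
    [AddCommGroup F] [Module ℝ F] [TopologicalSpace F] (f : E → F) (U : Set E) : Prop :=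
  ∀ n, IsCn n f U

theorem HasDirDeriv.eq {E : Type u} {F : Type v} [AddCommGroup E] [Module ℝ E]
    [AddCommGroup F] [Module ℝ F] [TopologicalSpace F] [T2Space F] {f : E → F} {x v : E} {l : F} (h : HasDirDeriv f x v l) :
    dirDeriv f x v = l :=
  Tendsto.limUnder_eq h

theorem HasDirDeriv.dirDeriv {E : Type u} {F : Type v} [AddCommGroup E] [Module ℝ E]
    [AddCommGroup F] [Module ℝ F] [TopologicalSpace F] [T2Space F] {f : E → F} {x v : E} {l : F}
    (h : HasDirDeriv f x v l) : HasDirDeriv f x v (dirDeriv f x v) := by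
  rw [h.eq]; exact h

section basic

variable {E : Type u} {F : Type v} [AddCommGroup E] [Module ℝ E] [TopologicalSpace E]
  [AddCommGroup F] [Module ℝ F] [TopologicalSpace F]

theorem IsCn.continuousOn {n : ℕ} {f : E → F} {U : Set E} (h : IsCn n f U) :
    ContinuousOn f U := by
  cases n with
  | zero => exact h
  | succ n => exact h.1

theorem HasDirDeriv.congr [ContinuousAdd E] [ContinuousSMul ℝ E] {f g : E → F} {x v : E}
    {l : F} {U : Set E} (hU : IsOpen U) (hx : x ∈ U) (hfg : EqOn f g U)
    (h : HasDirDeriv f x v l) : HasDirDeriv g x v l := by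
  have hc : ContinuousAt (fun t : ℝ => x + t • v) 0 := by fun_prop
  have : ∀ᶠ t : ℝ in 𝓝[≠] 0, x + t • v ∈ U :=
    nhdsWithin_le_nhds (hc (hU.mem_nhds (by simpa using hx)))
  refine Tendsto.congr' ?_ h
  filter_upwards [this] with t ht
  rw [hfg ht, hfg hx]

theorem IsCn.congr [ContinuousAdd E] [ContinuousSMul ℝ E] [T2Space F] {n : ℕ} {f g : E → F}
    {U : Set E} (h : IsCn n f U) (hU : IsOpen U) (hfg : EqOn f g U) : IsCn n g U := by
  induction n generalizing E with
  | zero => exact ContinuousOn.congr h hfg.symm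
  | succ n ih =>
    obtain ⟨h1, h2, h3⟩ := h
    have key : ∀ x ∈ U, ∀ v, HasDirDeriv g x v (LC.dirDeriv f x v) := fun x hx v =>
      (h2 x hx v).congr hU hx hfg
    refine ⟨h1.congr hfg.symm, fun x hx v => (key x hx v).dirDeriv,
      ih h3 (hU.prod isOpen_univ) ?_⟩
    intro p hp
    exact ((key p.1 hp.1 p.2).eq).symm

theorem IsCn.mono {n : ℕ} {f : E → F} {U V : Set E} (h : IsCn n f U) (hV : V ⊆ U) :
    IsCn n f V := by
  induction n generalizing E with
  | zero => exact ContinuousOn.mono h hV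
  | succ n ih =>
    exact ⟨h.1.mono hV, fun x hx v => h.2.1 x (hV hx) v, ih h.2.2 (prod_mono hV le_rfl)⟩

theorem IsCn.pred {n : ℕ} {f : E → F} {U : Set E} (h : IsCn (n + 1) f U) : IsCn n f U := by
  induction n generalizing E with
  | zero => exact h.1
  | succ n ih => exact ⟨h.1, h.2.1, ih h.2.2⟩

/-- Being of class `C^n` is a local property. -/
theorem IsCn.of_locally [ContinuousAdd E] [ContinuousSMul ℝ E] {n : ℕ} {f : E → F} {U : Set E}
    (h : ∀ x ∈ U, ∃ V, IsOpen V ∧ x ∈ V ∧ IsCn n f V) : IsCn n f U := by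
  have hc : ContinuousOn f U := fun x hx => by
    obtain ⟨V, hV, hxV, hf⟩ := h x hx
    exact (hf.continuousOn.continuousAt (hV.mem_nhds hxV)).continuousWithinAt
  induction n generalizing E with
  | zero => exact hc
  | succ n ih =>
    refine ⟨hc, fun x hx v => ?_, ih ?_ ?_⟩
    · obtain ⟨V, hV, hxV, hf⟩ := h x hx
      exact hf.2.1 x hxV v
    · intro p hp
      obtain ⟨V, hV, hxV, hf⟩ := h p.1 hp.1
      exact ⟨V ×ˢ univ, hV.prod isOpen_univ, ⟨hxV, trivial⟩, hf.2.2⟩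
    · intro p hp
      obtain ⟨V, hV, hxV, hf⟩ := h p.1 hp.1
      exact (hf.2.2.continuousOn.continuousAt
        ((hV.prod isOpen_univ).mem_nhds ⟨hxV, trivial⟩)).continuousWithinAt

theorem IsCn.comp_clm {E' : Type w} [AddCommGroup E'] [Module ℝ E'] [TopologicalSpace E']
    {n : ℕ} {f : E → F} {U : Set E} (h : IsCn n f U) (L : E' →L[ℝ] E) :
    IsCn n (fun x => f (L x)) (L ⁻¹' U) := by
  have key : ∀ x v, dirDeriv (fun x => f (L x)) x v = dirDeriv f (L x) (L v) := by
    intro x v; simp [dirDeriv]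
  induction n generalizing E E' with
  | zero => exact ContinuousOn.comp h L.continuous.continuousOn (fun _ hx => hx)
  | succ n ih =>
    refine ⟨h.1.comp L.continuous.continuousOn (fun _ hx => hx), fun x hx v => ?_, ?_⟩
    · rw [key]
      simpa [HasDirDeriv] using h.2.1 (L x) hx (L v)
    · simp only [key]
      exact ih h.2.2 (L.prodMap L) (by intro x v; simp [dirDeriv])

theorem IsCn.prodMk {F' : Type w} [AddCommGroup F'] [Module ℝ F'] [TopologicalSpace F']
    [T2Space F] [T2Space F'] [ContinuousAdd E] [ContinuousSMul ℝ E]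
    {n : ℕ} {f : E → F} {g : E → F'} {U : Set E} (hU : IsOpen U)
    (hf : IsCn n f U) (hg : IsCn n g U) : IsCn n (fun x => (f x, g x)) U := by
  induction n generalizing E with
  | zero => exact ContinuousOn.prodMk hf hg
  | succ n ih =>
    have key : ∀ x ∈ U, ∀ v, HasDirDeriv (fun x => (f x, g x)) x v
        (dirDeriv f x v, dirDeriv g x v) := fun x hx v =>
      (hf.2.1 x hx v).prodMk_nhds (hg.2.1 x hx v)
    refine ⟨hf.1.prodMk hg.1, fun x hx v => (key x hx v).dirDeriv, ?_⟩
    refine (ih (hU.prod isOpen_univ) hf.2.2 hg.2.2).congr (hU.prod isOpen_univ) ?_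
    intro p hp
    exact (key p.1 hp.1 p.2).eq.symm

/-- Continuous linear maps are smooth. -/
theorem isCn_clm [T2Space F] (n : ℕ) (L : E →L[ℝ] F) (U : Set E) : IsCn n L U := by
  have key : ∀ x v, HasDirDeriv L x v (L v) := by
    intro x v
    refine Tendsto.congr' ?_ tendsto_const_nhds
    filter_upwards [self_mem_nhdsWithin] with t ht
    have ht : t ≠ 0 := ht
    simp [smul_smul, ht]
  induction n generalizing E with
  | zero => exact L.continuous.continuousOn
  | succ n ih =>
    refine ⟨L.continuous.continuousOn, fun x _ v => (key x v).dirDeriv, ?_⟩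
    have : (fun p : E × E => dirDeriv L p.1 p.2) = L.comp (ContinuousLinearMap.snd ℝ E E) := by
      funext p; exact (key p.1 p.2).eq
    rw [this]
    refine ih _ _ ?_
    intro x v
    refine Tendsto.congr' ?_ tendsto_const_nhds
    filter_upwards [self_mem_nhdsWithin] with t ht
    have ht : t ≠ 0 := ht
    simp [smul_smul, ht]

/-- A map with values in a closed subspace is of class `C^n` as a map into the subspace if it is
of class `C^n` as a map into the ambient space. -/
theorem IsCn.of_isClosedEmbedding_comp {F' : Type w} [AddCommGroup F'] [Module ℝ F']
    [TopologicalSpace F'] [T2Space F] [T2Space F'] [ContinuousAdd E] [ContinuousSMul ℝ E]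
    {n : ℕ} {f : E → F} (j : F →L[ℝ] F')
    (hj : IsClosedEmbedding j) {U : Set E} (hU : IsOpen U) (h : IsCn n (fun x => j (f x)) U) :
    IsCn n f U := by
  have aux : ∀ {X : Type u} [TopologicalSpace X] {k : X → F} {s : Set X},
      ContinuousOn (fun x => j (k x)) s → ContinuousOn k s := fun hk =>
    (hj.isInducing.continuousOn_iff).2 hk
  induction n generalizing E with
  | zero => exact aux h
  | succ n ih =>
    have key : ∀ x ∈ U, ∀ v, ∃ l, HasDirDeriv f x v l ∧
        j l = dirDeriv (fun x => j (f x)) x v := by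
      intro x hx v
      have h2 := h.2.1 x hx v
      have h2' : Tendsto (fun t : ℝ => j (t⁻¹ • (f (x + t • v) - f x))) (𝓝[≠] 0)
          (𝓝 (dirDeriv (fun x => j (f x)) x v)) := by
        simpa [HasDirDeriv] using h2
      obtain ⟨l, hl⟩ := hj.isClosed_range.mem_of_tendsto h2'
        (Eventually.of_forall fun t => mem_range_self _)
      refine ⟨l, ?_, hl⟩
      rw [← hl] at h2'
      exact hj.isInducing.tendsto_nhds_iff.2 h2'
    refine ⟨aux h.1, fun x hx v => ?_, ih (hU.prod isOpen_univ) ?_⟩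
    · obtain ⟨l, hl, -⟩ := key x hx v
      exact hl.dirDeriv
    · refine h.2.2.congr (hU.prod isOpen_univ) ?_
      intro p hp
      obtain ⟨l, hl, hjl⟩ := key p.1 hp.1 p.2
      change dirDeriv (fun x => j (f x)) p.1 p.2 = j (dirDeriv f p.1 p.2)
      rw [hl.eq, hjl]

end basic

section chain

variable {E : Type u} {F : Type v} [AddCommGroup E] [Module ℝ E] [TopologicalSpace E]
  [IsTopologicalAddGroup E] [ContinuousSMul ℝ E]
  [AddCommGroup F] [Module ℝ F] [TopologicalSpace F]
  [IsTopologicalAddGroup F] [ContinuousSMul ℝ F] [LocallyConvexSpace ℝ F] [T2Space F]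

/-- Mean value theorem: a difference quotient lies in every closed convex set which contains the
directional derivatives along the segment. -/
theorem slope_mem_of_dirDeriv_mem {f : E → F} {x v : E} {t : ℝ} (ht : t ≠ 0) {K : Set F}
    (hK : IsClosed K) (hKc : Convex ℝ K)
    (h : ∀ s : ℝ, |s| ≤ |t| → HasDirDeriv f (x + s • v) v (dirDeriv f (x + s • v) v) ∧
      dirDeriv f (x + s • v) v ∈ K) : t⁻¹ • (f (x + t • v) - f x) ∈ K := by
  by_contra hn
  obtain ⟨l, c, hlc, hcl⟩ := geometric_hahn_banach_closed_point hKc hK hn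
  have hder : ∀ s : ℝ, |s| ≤ |t| → HasDerivAt (fun r : ℝ => l (f (x + r • v)))
      (l (dirDeriv f (x + s • v) v)) s := by
    intro s hs
    rw [hasDerivAt_iff_tendsto_slope_zero]
    have := (l.continuous.tendsto _).comp (h s hs).1
    refine this.congr fun r => ?_
    simp [add_smul, add_assoc]
  have hbd : ∀ s ∈ Icc (0 : ℝ) 1, |s * t| ≤ |t| := by
    intro s hs
    rw [abs_mul, abs_of_nonneg hs.1]
    exact mul_le_of_le_one_left (abs_nonneg _) hs.2
  have hder' : ∀ s ∈ Icc (0 : ℝ) 1, HasDerivAt (fun r : ℝ => t⁻¹ * l (f (x + (r * t) • v)))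
      (l (dirDeriv f (x + (s * t) • v) v)) s := by
    intro s hs
    have h1 := (hder (s * t) (hbd s hs)).comp s ((hasDerivAt_id s).mul_const t)
    have h2 := h1.const_mul t⁻¹
    have e : t⁻¹ * (l (dirDeriv f (x + (s * t) • v) v) * (1 * t)) =
        l (dirDeriv f (x + (s * t) • v) v) := by field_simp
    rw [e] at h2
    exact h2
  obtain ⟨s, hs, hs'⟩ := exists_hasDerivAt_eq_slope _ _ (zero_lt_one' ℝ)
    (fun s hs => (hder' s hs).continuousAt.continuousWithinAt)
    (fun s hs => hder' s (Ioo_subset_Icc_self hs))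
  have h3 := hlc _ (h (s * t) (hbd s (Ioo_subset_Icc_self hs))).2
  rw [hs'] at h3
  have h4 : l (t⁻¹ • (f (x + t • v) - f x)) =
      (t⁻¹ * l (f (x + (1 * t) • v)) - t⁻¹ * l (f (x + (0 * t) • v))) / (1 - 0) := by
    simp [mul_sub]
  rw [h4] at hcl
  exact lt_asymm h3 hcl

/-- For a `C^1` map, the difference quotients converge jointly in the base point and the
direction. -/
theorem IsCn.tendsto_slope {f : E → F} {U : Set E} (hU : IsOpen U) (h : IsCn 1 f U) {x : E}
    (hx : x ∈ U) (v : E) :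
    Tendsto (fun p : (E × E) × ℝ => p.2⁻¹ • (f (p.1.1 + p.2 • p.1.2) - f p.1.1))
      (𝓝 (x, v) ×ˢ 𝓝[≠] 0) (𝓝 (dirDeriv f x v)) := by
  rw [tendsto_def]
  intro C hC
  obtain ⟨C', hC', hC'cl, hC'C⟩ := exists_mem_nhds_isClosed_subset hC
  obtain ⟨S, hS, hSc, hSC'⟩ :=
    (locallyConvexSpace_iff_exists_convex_subset ℝ F).1 inferInstance _ C' hC'
  have hKC : closure S ⊆ C := (closure_minimal hSC' hC'cl).trans hC'C
  have hc : ContinuousAt (fun p : E × E => dirDeriv f p.1 p.2) (x, v) :=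
    h.2.2.continuousOn.continuousAt ((hU.prod isOpen_univ).mem_nhds ⟨hx, trivial⟩)
  have h1 : ∀ᶠ p in 𝓝 (x, v), p.1 ∈ U ∧ dirDeriv f p.1 p.2 ∈ closure S :=
    ((hU.prod isOpen_univ).mem_nhds ⟨hx, trivial⟩ |> fun hm =>
      (show ∀ᶠ p in 𝓝 (x, v), p ∈ U ×ˢ univ from hm).mono fun p hp => hp.1).and
      (hc (mem_of_superset hS subset_closure))
  have hc2 : ContinuousAt (fun p : (E × E) × ℝ => (p.1.1 + p.2 • p.1.2, p.1.2))
      ((x, v), (0 : ℝ)) := by fun_prop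
  have h2 : ∀ᶠ p : (E × E) × ℝ in 𝓝 (x, v) ×ˢ 𝓝 (0 : ℝ), p.1.1 + p.2 • p.1.2 ∈ U ∧
      dirDeriv f (p.1.1 + p.2 • p.1.2) p.1.2 ∈ closure S := by
    rw [← nhds_prod_eq]
    refine hc2.eventually (p := fun q : E × E => q.1 ∈ U ∧ dirDeriv f q.1 q.2 ∈ closure S) ?_
    simpa only [zero_smul, add_zero] using h1
  obtain ⟨A, hA, B, hB, hAB⟩ := eventually_prod_iff.1 h2
  obtain ⟨r, hr, hrB⟩ := Metric.eventually_nhds_iff.1 hB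
  have h3 : ∀ᶠ t : ℝ in 𝓝[≠] 0, t ≠ 0 ∧ |t| < r := by
    filter_upwards [self_mem_nhdsWithin, nhdsWithin_le_nhds (Metric.ball_mem_nhds 0 hr)]
      with t ht ht'
    exact ⟨ht, by simpa using ht'⟩
  refine mem_of_superset (prod_mem_prod hA h3) ?_
  rintro ⟨p, t⟩ ⟨hp, ht0, htr⟩
  refine hKC (slope_mem_of_dirDeriv_mem ht0 isClosed_closure hSc.closure fun s hs => ?_)
  have hs' : B s := hrB (by simpa using hs.trans_lt htr)
  exact ⟨h.2.1 _ (hAB hp hs').1 _, (hAB hp hs').2⟩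

/-- Chain rule. -/
theorem HasDirDeriv.comp {D : Type w} [AddCommGroup D] [Module ℝ D]
    {g : E → F} {V : Set E} (hV : IsOpen V) (hg : IsCn 1 g V)
    {f : D → E} {x v : D} {l : E} (hf : HasDirDeriv f x v l) (hx : f x ∈ V) :
    HasDirDeriv (fun z => g (f z)) x v (LC.dirDeriv g (f x) l) := by
  have h1 := (hg.tendsto_slope hV hx l).comp
    (((tendsto_const_nhds (x := f x)).prodMk_nhds hf).prodMk tendsto_id)
  refine h1.congr' ?_
  filter_upwards [self_mem_nhdsWithin] with t ht
  have ht : t ≠ 0 := ht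
  simp [smul_smul, ht]

/-- Compositions of `C^n` maps are of class `C^n`. -/
theorem IsCn.comp {D : Type w} [AddCommGroup D] [Module ℝ D] [TopologicalSpace D]
    [ContinuousAdd D] [ContinuousSMul ℝ D] [T2Space E] {n : ℕ} {g : E → F} {V : Set E}
    (hV : IsOpen V) (hg : IsCn n g V) {f : D → E} {U : Set D} (hU : IsOpen U) (hf : IsCn n f U)
    (hUV : MapsTo f U V) : IsCn n (fun z => g (f z)) U := by
  induction n generalizing E D with
  | zero => exact ContinuousOn.comp hg hf hUV
  | succ n ih =>
    have hg1 : IsCn 1 g V := ⟨hg.1, hg.2.1, hg.2.2.continuousOn⟩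
    have key : ∀ x ∈ U, ∀ v, HasDirDeriv (fun z => g (f z)) x v
        (dirDeriv g (f x) (dirDeriv f x v)) := fun x hx v =>
      (hf.2.1 x hx v).comp hV hg1 (hUV hx)
    refine ⟨hg.1.comp hf.1 hUV, fun x hx v => (key x hx v).dirDeriv, ?_⟩
    have hfst : IsCn n (fun p : D × D => f p.1) (U ×ˢ univ) :=
      (hf.pred.comp_clm (ContinuousLinearMap.fst ℝ D D)).mono fun p hp => hp.1
    have h1 : IsCn n (fun p : D × D => (f p.1, dirDeriv f p.1 p.2)) (U ×ˢ univ) :=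
      hfst.prodMk (hU.prod isOpen_univ) hf.2.2
    refine (ih (hV.prod isOpen_univ) hg.2.2 (hU.prod isOpen_univ) h1
      (fun p hp => ⟨hUV hp.1, trivial⟩)).congr (hU.prod isOpen_univ) ?_
    intro p hp
    exact (key p.1 hp.1 p.2).eq.symm

end chain

end Calculus


section Manifolds

/-- A real Hausdorff locally convex topological vector space. -/
structure LCSpace : Type (u + 1) where
  carrier : Type u
  [addCommGroup : AddCommGroup carrier]
  [module : Module ℝ carrier]
  [topologicalSpace : TopologicalSpace carrier]
  [isTopologicalAddGroup : IsTopologicalAddGroup carrier]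
  [continuousSMul : ContinuousSMul ℝ carrier]
  [locallyConvexSpace : LocallyConvexSpace ℝ carrier]
  [t2Space : T2Space carrier]

attribute [instance] LCSpace.addCommGroup LCSpace.module LCSpace.topologicalSpace
  LCSpace.isTopologicalAddGroup LCSpace.continuousSMul LCSpace.locallyConvexSpace
  LCSpace.t2Space

instance : CoeSort LCSpace.{u} (Type u) := ⟨LCSpace.carrier⟩

/-- The product of two locally convex spaces. -/
def LCSpace.prod (E : LCSpace.{u}) (F : LCSpace.{v}) : LCSpace.{max u v} where
  carrier := E × F

/-- A linear subspace of a locally convex space, with the subspace topology. -/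
def LCSpace.sub (E : LCSpace.{u}) (F : Submodule ℝ E) : LCSpace.{u} where
  carrier := F

/-- A chart of `M`: a homeomorphism from an open subset of `M` onto an open subset of some
locally convex space, which may vary with the chart. -/
structure Chart (M : Type u) [TopologicalSpace M] : Type (u + 1) where
  space : LCSpace.{u}
  map : OpenPartialHomeomorph M space

/-- The change of charts from `c` to `c'`. -/
def Chart.change {M : Type u} [TopologicalSpace M] (c c' : Chart M) : c.space → c'.space :=
  fun x => c'.map (c.map.symm x)

/-- The domain of the change of charts from `c` to `c'`. -/
def Chart.overlap {M : Type u} [TopologicalSpace M] (c c' : Chart M) : Set c.space :=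
  c.map.target ∩ c.map.symm ⁻¹' c'.map.source

theorem Chart.isOpen_overlap {M : Type u} [TopologicalSpace M] (c c' : Chart M) :
    IsOpen (c.overlap c') :=
  c.map.isOpen_inter_preimage_symm c'.map.open_source

/-- A smooth manifold modeled on locally convex spaces. -/
class Manifold (M : Type u) [TopologicalSpace M] : Type (u + 1) where
  atlas : Set (Chart M)
  exists_chart : ∀ p : M, ∃ c ∈ atlas, p ∈ c.map.source
  smooth_change : ∀ c ∈ atlas, ∀ c' ∈ atlas, IsSmooth (c.change c') (c.overlap c')

/-- The charts which are compatible with the given atlas. -/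
def maximalAtlas (M : Type u) [TopologicalSpace M] [Manifold M] : Set (Chart M) :=
  {c | ∀ c' ∈ Manifold.atlas (M := M),
    IsSmooth (c.change c') (c.overlap c') ∧ IsSmooth (c'.change c) (c'.overlap c)}

/-- The map `f` is smooth on the open set `W`. -/
def SmoothOn {M : Type u} {N : Type v} [TopologicalSpace M] [Manifold M] [TopologicalSpace N]
    [Manifold N] (f : M → N) (W : Set M) : Prop :=
  ContinuousOn f W ∧ ∀ c ∈ Manifold.atlas (M := M), ∀ c' ∈ Manifold.atlas (M := N),
    IsSmooth (fun x => c'.map (f (c.map.symm x)))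
      (c.map.target ∩ c.map.symm ⁻¹' (W ∩ f ⁻¹' c'.map.source))

/-- The map `f` restricts to a diffeomorphism from the open set `A` onto the open set `B`. -/
structure IsDiffeoOn {M : Type u} {N : Type v} [TopologicalSpace M] [Manifold M]
    [TopologicalSpace N] [Manifold N] (f : M → N) (A : Set M) (B : Set N) : Prop where
  isOpen_source : IsOpen A
  isOpen_target : IsOpen B
  bijOn : BijOn f A B
  smoothOn : SmoothOn f A
  smoothOn_inv : ∃ g : N → M, InvOn g f A B ∧ SmoothOn g B

/-- The map `f` is a local diffeomorphism at `x`. -/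
def IsLocalDiffeoAt {M : Type u} {N : Type v} [TopologicalSpace M] [Manifold M]
    [TopologicalSpace N] [Manifold N] (f : M → N) (x : M) : Prop :=
  ∃ A B, x ∈ A ∧ IsDiffeoOn f A B

/-- A locally convex space is a manifold, with the identity as a chart. -/
instance LCSpace.instManifold (E : LCSpace.{u}) : Manifold E where
  atlas := {⟨E, OpenPartialHomeomorph.refl E⟩}
  exists_chart p := ⟨_, rfl, mem_univ p⟩
  smooth_change := by
    rintro _ rfl _ rfl n
    exact isCn_clm n (ContinuousLinearMap.id ℝ E) _

/-- The product of two charts. -/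
def Chart.prod {M : Type u} {N : Type v} [TopologicalSpace M] [TopologicalSpace N]
    (c : Chart M) (d : Chart N) : Chart (M × N) where
  space := c.space.prod d.space
  map := c.map.prod d.map

/-- The product of two manifolds. -/
instance instManifoldProd {M : Type u} {N : Type v} [TopologicalSpace M] [Manifold M]
    [TopologicalSpace N] [Manifold N] : Manifold (M × N) where
  atlas := {e | ∃ c ∈ Manifold.atlas (M := M), ∃ d ∈ Manifold.atlas (M := N), e = c.prod d}
  exists_chart p := by
    obtain ⟨c, hc, hpc⟩ := Manifold.exists_chart p.1
    obtain ⟨d, hd, hpd⟩ := Manifold.exists_chart p.2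
    exact ⟨_, ⟨c, hc, d, hd, rfl⟩, hpc, hpd⟩
  smooth_change := by
    rintro _ ⟨c, hc, d, hd, rfl⟩ _ ⟨c', hc', d', hd', rfl⟩ n
    have ho : IsOpen ((c.overlap c') ×ˢ (d.overlap d')) :=
      (c.isOpen_overlap c').prod (d.isOpen_overlap d')
    have h1 := ((Manifold.smooth_change c hc c' hc' n).comp_clm
      (ContinuousLinearMap.fst ℝ c.space d.space)).mono
      (V := (c.overlap c') ×ˢ (d.overlap d')) fun p hp => hp.1
    have h2 := ((Manifold.smooth_change d hd d' hd' n).comp_clm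
      (ContinuousLinearMap.snd ℝ c.space d.space)).mono
      (V := (c.overlap c') ×ˢ (d.overlap d')) fun p hp => hp.2
    refine IsCn.mono (h1.prodMk ho h2) ?_
    rintro p ⟨⟨h1, h2⟩, ⟨h3, h4⟩⟩
    exact ⟨⟨h1, h3⟩, ⟨h2, h4⟩⟩

section Tangent

variable {M : Type u} [TopologicalSpace M] [Manifold M]

theorem atlas_subset_maximalAtlas : Manifold.atlas (M := M) ⊆ maximalAtlas M :=
  fun c hc c' hc' => ⟨Manifold.smooth_change c hc c' hc', Manifold.smooth_change c' hc' c hc⟩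

theorem smooth_change_of_mem_maximalAtlas {c c' : Chart M} (hc : c ∈ maximalAtlas M)
    (hc' : c' ∈ maximalAtlas M) : IsSmooth (c.change c') (c.overlap c') := by
  intro n
  refine IsCn.of_locally fun x hx => ?_
  obtain ⟨b, hb, hxb⟩ := Manifold.exists_chart (c.map.symm x)
  have ho : IsOpen (c.overlap c' ∩ c.overlap b) :=
    (c.isOpen_overlap c').inter (c.isOpen_overlap b)
  refine ⟨c.overlap c' ∩ c.overlap b, ho, ⟨hx, hx.1, hxb⟩, ?_⟩
  have h1 : IsCn n (c.change b) (c.overlap c' ∩ c.overlap b) :=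
    ((hc b hb).1 n).mono inter_subset_right
  have h2 : IsCn n (b.change c') (b.overlap c') := (hc' b hb).2 n
  refine (h2.comp (b.isOpen_overlap c') ho h1 ?_).congr ho ?_
  · rintro y ⟨⟨hy1, hy2⟩, ⟨-, hy3⟩⟩
    refine ⟨b.map.map_source hy3, ?_⟩
    simpa only [mem_preimage, Chart.change, b.map.left_inv hy3] using hy2
  · rintro y ⟨⟨hy1, hy2⟩, ⟨-, hy3⟩⟩
    simp only [Chart.change, b.map.left_inv hy3]

/-- Chain rule for changes of charts. -/
theorem dirDeriv_change_comp {a b c : Chart M} (ha : a ∈ maximalAtlas M)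
    (hb : b ∈ maximalAtlas M) (hc : c ∈ maximalAtlas M) {x : a.space} (hxa : x ∈ a.map.target)
    (hxb : a.map.symm x ∈ b.map.source) (hxc : a.map.symm x ∈ c.map.source) (v : a.space) :
    dirDeriv (b.change c) (a.change b x) (dirDeriv (a.change b) x v) =
      dirDeriv (a.change c) x v := by
  have hbc := smooth_change_of_mem_maximalAtlas hb hc 1
  have hab := smooth_change_of_mem_maximalAtlas ha hb 1
  have hx : a.change b x ∈ b.overlap c := by
    refine ⟨b.map.map_source hxb, ?_⟩
    simpa only [mem_preimage, Chart.change, b.map.left_inv hxb] using hxc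
  have h1 := (hab.2.1 x ⟨hxa, hxb⟩ v).comp (b.isOpen_overlap c) hbc hx
  have h2 := HasDirDeriv.congr (g := a.change c) (a.isOpen_overlap b) ⟨hxa, hxb⟩ (by
    rintro y ⟨-, hy⟩
    simp only [Chart.change, b.map.left_inv hy]) h1
  exact h2.eq.symm

theorem dirDeriv_change_self {a : Chart M} {x : a.space} (hxa : x ∈ a.map.target)
    (v : a.space) : dirDeriv (a.change a) x v = v := by
  have h0 : HasDirDeriv (fun y : a.space => y) x v v := by
    refine Tendsto.congr' ?_ tendsto_const_nhds
    filter_upwards [self_mem_nhdsWithin] with t ht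
    have ht : t ≠ 0 := ht
    simp [smul_smul, ht]
  exact (h0.congr a.map.open_target hxa fun y hy => (a.map.right_inv hy).symm).eq

/-- A preferred chart around `p`. -/
def chartAt (p : M) : Chart M := (Manifold.exists_chart p).choose

theorem chartAt_mem (p : M) : chartAt p ∈ Manifold.atlas (M := M) :=
  (Manifold.exists_chart p).choose_spec.1

theorem mem_chartAt_source (p : M) : p ∈ (chartAt p).map.source :=
  (Manifold.exists_chart p).choose_spec.2

/-- The tangent space of `M` at `p`, realized as the model space of the preferred chart. -/
def TangentSpace (p : M) : LCSpace.{u} := (chartAt p).space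

/-- The derivative at `p` of the chart `c`, as a map `T_p M → c.space`. -/
def Chart.deriv (c : Chart M) (p : M) (v : TangentSpace p) : c.space :=
  dirDeriv ((chartAt p).change c) ((chartAt p).map p) v

/-- The derivative at `x` of the inverse of the chart `c`. -/
def Chart.derivSymm (c : Chart M) (x : c.space) (v : c.space) : TangentSpace (c.map.symm x) :=
  dirDeriv (c.change (chartAt (c.map.symm x))) x v

/-- The tangent map `T_p M → T_{f p} N` of `f : M → N`, computed in the preferred charts. -/
def tangentMap {N : Type v} [TopologicalSpace N] [Manifold N] (f : M → N) (p : M)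
    (v : TangentSpace p) : TangentSpace (f p) :=
  dirDeriv (fun x => (chartAt (f p)).map (f ((chartAt p).map.symm x))) ((chartAt p).map p) v

variable (M) in
/-- The tangent bundle of `M`. -/
structure TangentBundle : Type u where
  proj : M
  vec : TangentSpace proj

/-- The map `TM → TN` induced by `f : M → N`. -/
def TangentBundle.map {N : Type v} [TopologicalSpace N] [Manifold N] (f : M → N)
    (X : TangentBundle M) : TangentBundle N :=
  ⟨f X.proj, tangentMap f X.proj X.vec⟩

theorem dirDeriv_change_deriv {c c' : Chart M} (hc : c ∈ maximalAtlas M)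
    (hc' : c' ∈ maximalAtlas M) {p : M} (hp : p ∈ c.map.source) (hp' : p ∈ c'.map.source)
    (v : TangentSpace p) :
    dirDeriv (c.change c') (c.map p) (c.deriv p v) = c'.deriv p v := by
  have hk := mem_chartAt_source p
  have := dirDeriv_change_comp (atlas_subset_maximalAtlas (chartAt_mem p)) hc hc'
    ((chartAt p).map.map_source hk) (by rwa [(chartAt p).map.left_inv hk])
    (by rwa [(chartAt p).map.left_inv hk]) v
  have e : (chartAt p).change c ((chartAt p).map p) = c.map p :=
    congrArg c.map ((chartAt p).map.left_inv hk)
  rw [e] at this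
  exact this

theorem Chart.deriv_derivSymm {c c' : Chart M} (hc : c ∈ maximalAtlas M)
    (hc' : c' ∈ maximalAtlas M) {x : c.space} (hx : x ∈ c.overlap c') (v : c.space) :
    c'.deriv (c.map.symm x) (c.derivSymm x v) = dirDeriv (c.change c') x v :=
  dirDeriv_change_comp hc (atlas_subset_maximalAtlas (chartAt_mem _)) hc' hx.1
    (mem_chartAt_source _) hx.2 v

/-- The bundle chart of `TM` induced by a chart of `M`, as a bijection
`TM|_V ≃ c(V) × c.space`. -/
def Chart.tangentEquiv (c : Chart M) (hc : c ∈ maximalAtlas M) :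
    PartialEquiv (TangentBundle M) (c.space.prod c.space) where
  toFun X := (c.map X.proj, c.deriv X.proj X.vec)
  invFun q := ⟨c.map.symm q.1, c.derivSymm q.1 q.2⟩
  source := {X | X.proj ∈ c.map.source}
  target := {q | q.1 ∈ c.map.target}
  map_source' X hX := c.map.map_source hX
  map_target' q hq := c.map.map_target hq
  left_inv' := by
    rintro ⟨p, v⟩ (hp : p ∈ c.map.source)
    have hk := mem_chartAt_source p
    have h1 := dirDeriv_change_deriv hc (atlas_subset_maximalAtlas (chartAt_mem p)) hp hk v
    have h2 : (chartAt p).deriv p v = v :=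
      dirDeriv_change_self ((chartAt p).map.map_source hk) v
    rw [h2] at h1
    have key : ∀ q, q = p → ∀ w : c.space, (⟨q, dirDeriv (c.change (chartAt q)) (c.map p) w⟩ :
        TangentBundle M) = ⟨p, dirDeriv (c.change (chartAt p)) (c.map p) w⟩ := by
      rintro q rfl w; rfl
    exact (key _ (c.map.left_inv hp) _).trans (congrArg (TangentBundle.mk p) h1)
  right_inv' := by
    rintro ⟨x, v⟩ (hx : x ∈ c.map.target)
    refine Prod.ext (c.map.right_inv hx) ?_
    exact (Chart.deriv_derivSymm hc hc ⟨hx, c.map.map_target hx⟩ v).trans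
      (dirDeriv_change_self hx v)

/-- The topology of `TM`: a set is open if it is open in all bundle charts. -/
instance TangentBundle.instTopologicalSpace : TopologicalSpace (TangentBundle M) where
  IsOpen U := ∀ c, ∀ hc : c ∈ Manifold.atlas (M := M),
    IsOpen {q : c.space.prod c.space | q.1 ∈ c.map.target ∧
      (c.tangentEquiv (atlas_subset_maximalAtlas hc)).symm q ∈ U}
  isOpen_univ c hc := by
    simp only [mem_univ, and_true]
    exact c.map.open_target.preimage continuous_fst
  isOpen_inter U V hU hV c hc := by
    convert (hU c hc).inter (hV c hc) using 1
    ext q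
    simp only [mem_inter_iff, mem_ofPred_eq]
    tauto
  isOpen_sUnion s hs c hc := by
    convert isOpen_biUnion fun U hU => hs U hU c hc using 1
    ext q
    simp only [mem_sUnion, mem_iUnion, mem_ofPred_eq]
    tauto

/-- Changes of bundle charts are smooth. -/
theorem isSmooth_tangent_change {c c' : Chart M} (hc : c ∈ maximalAtlas M)
    (hc' : c' ∈ maximalAtlas M) :
    IsSmooth (fun q : c.space.prod c.space =>
        c'.tangentEquiv hc' ((c.tangentEquiv hc).symm q))
      {q : c.space.prod c.space | q.1 ∈ c.overlap c'} := by
  intro n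
  have h := smooth_change_of_mem_maximalAtlas hc hc'
  have ho : IsOpen {q : c.space.prod c.space | q.1 ∈ c.overlap c'} :=
    (c.isOpen_overlap c').preimage continuous_fst
  have h1 : IsCn n (fun q : c.space.prod c.space => c.change c' q.1)
      {q : c.space.prod c.space | q.1 ∈ c.overlap c'} :=
    (h n).comp_clm (ContinuousLinearMap.fst ℝ c.space c.space)
  have h2 : IsCn n (fun q : c.space.prod c.space => dirDeriv (c.change c') q.1 q.2)
      {q : c.space.prod c.space | q.1 ∈ c.overlap c'} :=
    (h (n + 1)).2.2.mono fun q hq => ⟨hq, trivial⟩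
  refine IsCn.congr (h1.prodMk ho h2) ho ?_
  intro q hq
  exact Prod.ext rfl (Chart.deriv_derivSymm hc hc' hq q.2).symm

/-- The bundle chart of `TM` induced by a chart of `M`. -/
def Chart.tangent (c : Chart M) (hc : c ∈ Manifold.atlas (M := M)) : Chart (TangentBundle M) where
  space := c.space.prod c.space
  map :=
    { toPartialEquiv := c.tangentEquiv (atlas_subset_maximalAtlas hc)
      open_source := by
        intro c' hc'
        exact (c'.isOpen_overlap c).preimage continuous_fst
      open_target := c.map.open_target.preimage continuous_fst
      continuousOn_toFun := by
        rw [continuousOn_iff']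
        intro O hO
        refine ⟨_, ?_, (inter_eq_left.2 inter_subset_right).symm⟩
        intro c' hc'
        have h := (isSmooth_tangent_change (atlas_subset_maximalAtlas hc')
          (atlas_subset_maximalAtlas hc) 0).continuousOn.isOpen_inter_preimage
          ((c'.isOpen_overlap c).preimage continuous_fst) hO
        convert h using 1
        ext q
        constructor
        · rintro ⟨h1, h2, h3⟩
          exact ⟨⟨h1, h3⟩, h2⟩
        · rintro ⟨⟨h1, h3⟩, h2⟩
          exact ⟨h1, h2, h3⟩
      continuousOn_invFun := by
        rw [continuousOn_iff']
        intro O hO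
        refine ⟨_, hO c hc, ?_⟩
        ext q
        constructor
        · rintro ⟨h1, h2⟩
          exact ⟨⟨h2, h1⟩, h2⟩
        · rintro ⟨⟨h2, h1⟩, -⟩
          exact ⟨h1, h2⟩ }

/-- The tangent bundle is a manifold, with the bundle charts as an atlas. -/
instance TangentBundle.instManifold : Manifold (TangentBundle M) where
  atlas := {e | ∃ c, ∃ hc : c ∈ Manifold.atlas (M := M), e = c.tangent hc}
  exists_chart X := ⟨_, ⟨_, chartAt_mem X.proj, rfl⟩, mem_chartAt_source X.proj⟩
  smooth_change := by
    rintro _ ⟨c, hc, rfl⟩ _ ⟨c', hc', rfl⟩ n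
    exact (isSmooth_tangent_change (atlas_subset_maximalAtlas hc)
      (atlas_subset_maximalAtlas hc') n).mono fun q hq => hq

end Tangent

section Submanifold

variable {M : Type u} [TopologicalSpace M] [Manifold M]

/-- In the chart `c`, the subset `S` corresponds to the closed linear subspace `F`. -/
structure IsSliceChart (S : Set M) (c : Chart M) (F : Submodule ℝ c.space) : Prop where
  mem_maximalAtlas : c ∈ maximalAtlas M
  isClosed : IsClosed (F : Set c.space)
  mem_iff : ∀ p ∈ c.map.source, p ∈ S ↔ c.map p ∈ F

/-- `S` is a submanifold of `M`: around each of its points there is a chart of `M` in which `S`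
corresponds to a closed linear subspace. -/
class IsSubmanifold (S : Set M) : Prop where
  exists_sliceChart : ∀ p ∈ S, ∃ c : Chart M, p ∈ c.map.source ∧ ∃ F, IsSliceChart S c F

open scoped Classical in
/-- The restriction of a chart of `M` to a submanifold `S`, as a homeomorphism from an open subset
of `S` onto an open subset of the subspace `F`. The point `s` of `S` only serves as a value outside
of the domain. -/
def IsSliceChart.homeo {S : Set M} {c : Chart M} {F : Submodule ℝ c.space}
    (h : IsSliceChart S c F) (s : S) : OpenPartialHomeomorph S F where
  toFun p := if hp : c.map p ∈ F then ⟨c.map p, hp⟩ else 0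
  invFun x := if hx : c.map.symm x ∈ S then ⟨c.map.symm x, hx⟩ else s
  source := Subtype.val ⁻¹' c.map.source
  target := Subtype.val ⁻¹' c.map.target
  map_source' := by
    intro p hp
    rw [dif_pos ((h.mem_iff p hp).1 p.2)]
    exact c.map.map_source hp
  map_target' := by
    intro x hx
    have hx' := c.map.map_target hx
    rw [dif_pos ((h.mem_iff _ hx').2 (by rw [c.map.right_inv hx]; exact x.2))]
    exact hx'
  left_inv' := by
    intro p hp
    have h1 : c.map p ∈ F := (h.mem_iff p hp).1 p.2
    have h2 : c.map.symm (c.map p) = p := c.map.left_inv hp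
    simp [dif_pos h1, h2]
  right_inv' := by
    intro x hx
    have hx' := c.map.map_target hx
    have h2 : c.map (c.map.symm x) = x := c.map.right_inv hx
    have h1 : c.map.symm x ∈ S := (h.mem_iff _ hx').2 (by rw [h2]; exact x.2)
    simp [dif_pos h1, h2]
  open_source := c.map.open_source.preimage continuous_subtype_val
  open_target := c.map.open_target.preimage continuous_subtype_val
  continuousOn_toFun := by
    refine IsInducing.subtypeVal.continuousOn_iff.2 ?_
    refine (c.map.continuousOn.comp continuous_subtype_val.continuousOn
      (fun (p : S) (hp : (p : M) ∈ c.map.source) => hp)).congr ?_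
    intro p hp
    have h1 : c.map p ∈ F := (h.mem_iff p hp).1 p.2
    simp [dif_pos h1]
  continuousOn_invFun := by
    refine IsInducing.subtypeVal.continuousOn_iff.2 ?_
    refine (c.map.continuousOn_symm.comp continuous_subtype_val.continuousOn
      (fun (x : F) (hx : (x : c.space) ∈ c.map.target) => hx)).congr ?_
    intro x hx
    have h1 : c.map.symm x ∈ S := (h.mem_iff _ (c.map.map_target hx)).2
      (by rw [c.map.right_inv hx]; exact x.2)
    simp only [Function.comp_apply, dif_pos h1]

theorem IsSliceChart.homeo_apply {S : Set M} {c : Chart M} {F : Submodule ℝ c.space}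
    (h : IsSliceChart S c F) (s : S) {p : S} (hp : (p : M) ∈ c.map.source) :
    (h.homeo s p : c.space) = c.map p := by
  have e : h.homeo s p = ⟨c.map p, (h.mem_iff p hp).1 p.2⟩ := dif_pos ((h.mem_iff p hp).1 p.2)
  rw [e]

theorem IsSliceChart.homeo_symm_apply {S : Set M} {c : Chart M} {F : Submodule ℝ c.space}
    (h : IsSliceChart S c F) (s : S) {x : F} (hx : (x : c.space) ∈ c.map.target) :
    ((h.homeo s).symm x : M) = c.map.symm x := by
  have h1 : c.map.symm x ∈ S := (h.mem_iff _ (c.map.map_target hx)).2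
    (by rw [c.map.right_inv hx]; exact x.2)
  have e : (h.homeo s).symm x = ⟨c.map.symm x, h1⟩ := dif_pos h1
  rw [e]

/-- The chart of a submanifold `S` which is obtained by restriction of a chart of `M`. -/
def IsSliceChart.restrict {S : Set M} {c : Chart M} {F : Submodule ℝ c.space}
    (h : IsSliceChart S c F) (s : S) : Chart S where
  space := c.space.sub F
  map := h.homeo s

/-- The manifold structure of a submanifold. -/
instance IsSubmanifold.instManifold (S : Set M) [IsSubmanifold S] : Manifold S where
  atlas := {e | ∃ c F, ∃ h : IsSliceChart S c F, ∃ s, e = h.restrict s}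
  exists_chart p := by
    obtain ⟨c, hp, F, h⟩ := IsSubmanifold.exists_sliceChart p.1 p.2
    exact ⟨_, ⟨c, F, h, p, rfl⟩, hp⟩
  smooth_change := by
    rintro _ ⟨c, F, h, s, rfl⟩ _ ⟨c', F', h', s', rfl⟩ n
    have hj' : IsClosedEmbedding F'.subtypeL := h'.isClosed.isClosedEmbedding_subtypeVal
    have hs := smooth_change_of_mem_maximalAtlas h.mem_maximalAtlas h'.mem_maximalAtlas n
    have ho : IsOpen (F.subtypeL ⁻¹' c.overlap c') :=
      (c.isOpen_overlap c').preimage continuous_subtype_val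
    have h1 : ∀ x ∈ F.subtypeL ⁻¹' c.overlap c',
        c.change c' (F.subtypeL x) = F'.subtypeL (h'.homeo s' ((h.homeo s).symm x)) := by
      rintro x ⟨hx, hx'⟩
      have e1 := h.homeo_symm_apply s hx
      refine ((h'.homeo_apply s' (p := (h.homeo s).symm x) ?_).trans ?_).symm
      · rw [e1]; exact hx'
      · rw [e1]; rfl
    refine IsCn.mono (IsCn.of_isClosedEmbedding_comp F'.subtypeL hj' ho
      ((hs.comp_clm F.subtypeL).congr ho h1)) ?_
    rintro x ⟨hx, hx'⟩
    refine ⟨hx, ?_⟩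
    have e1 := h.homeo_symm_apply s hx
    change c.map.symm x.val ∈ c'.map.source
    rw [← e1]
    exact hx'

end Submanifold

end Manifolds

section NormalBundle

variable {M : Type u} [TopologicalSpace M] [Manifold M]

/-- The tangent space `T_p P ⊆ T_p M` of a submanifold `P` at `p ∈ P`: in a chart of `M` in which
`P` corresponds to the subspace `F`, it corresponds to `F`. -/
def tangentSubspace (P : Set M) (p : M) : Set (TangentSpace p) :=
  {v | ∃ c F, IsSliceChart P c F ∧ p ∈ c.map.source ∧ c.deriv p v ∈ F}

/-- `N p` is a topological complement of `T_p P` in `T_p M` for every `p ∈ P`: there is a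
continuous linear projection of `T_p M` onto `N p` with kernel `T_p P`. -/
def IsNormalComplement (P : Set M) (N : ∀ p : M, Submodule ℝ (TangentSpace p)) : Prop :=
  ∀ p ∈ P, ∃ π : TangentSpace p →L[ℝ] TangentSpace p,
    (∀ v, π v ∈ N p) ∧ (∀ v ∈ N p, π v = v) ∧ ∀ v, π v = 0 ↔ v ∈ tangentSubspace P p

/-- A local trivialization of `TM|_P`, over the domain of a chart of `P`, which maps `N` to
`P × E₀` for a closed subspace `E₀` of the typical fiber. -/
structure SubbundleChart (P : Set M) (N : ∀ p : M, Submodule ℝ (TangentSpace p)) where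
  chart : Chart M
  F : Submodule ℝ chart.space
  isSliceChart : IsSliceChart P chart F
  /-- At a point with coordinate `x`, the trivialization sends a tangent vector which is
  represented by `v` in the chart to `triv x v`. -/
  triv : chart.space.sub F → (chart.space ≃L[ℝ] chart.space)
  smooth_triv : IsSmooth (fun q : chart.space.sub F × chart.space => triv q.1 q.2)
    {q | q.1.val ∈ chart.map.target}
  smooth_triv_symm : IsSmooth (fun q : chart.space.sub F × chart.space => (triv q.1).symm q.2)
    {q | q.1.val ∈ chart.map.target}
  E₀ : Submodule ℝ chart.space
  isClosed : IsClosed (E₀ : Set chart.space)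
  mem_iff : ∀ p, ∀ hp : p ∈ chart.map.source, ∀ hpP : p ∈ P, ∀ v : TangentSpace p,
    v ∈ N p ↔ triv ⟨chart.map p, (isSliceChart.mem_iff p hp).1 hpP⟩ (chart.deriv p v) ∈ E₀

/-- The inverse of the chart of the total space of `N` which is defined by a local
trivialization. -/
def SubbundleChart.param {P : Set M} {N : ∀ p : M, Submodule ℝ (TangentSpace p)}
    (κ : SubbundleChart P N) (q : κ.chart.space.sub κ.F × κ.chart.space.sub κ.E₀) :
    TangentBundle M :=
  ⟨κ.chart.map.symm q.1.val, κ.chart.derivSymm q.1.val ((κ.triv q.1).symm q.2.val)⟩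

/-- The family `N` is a smooth vector subbundle of `TM|_P`. -/
def IsSmoothSubbundle (P : Set M) (N : ∀ p : M, Submodule ℝ (TangentSpace p)) : Prop :=
  ∀ p ∈ P, ∃ κ : SubbundleChart P N, p ∈ κ.chart.map.source

/-- `η : TM ⊇ U → M` is a local addition. -/
structure IsLocalAddition (U : Set (TangentBundle M)) (η : TangentBundle M → M) : Prop where
  isOpen : IsOpen U
  zero_mem : ∀ p : M, ⟨p, 0⟩ ∈ U
  smoothOn : SmoothOn η U
  map_zero : ∀ p : M, η ⟨p, 0⟩ = p
  isDiffeoOn : ∃ B : Set (M × M), (∀ p, (p, p) ∈ B) ∧ IsDiffeoOn (fun X => (X.proj, η X)) U B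

/-- The restriction of `η` to the total space of the subbundle `N` of `TM|_P` is a local
diffeomorphism (into `M`) at every point of the zero section. The smooth structure of the total
space is given by the charts which are induced by local trivializations. -/
def IsAdapted (η : TangentBundle M → M) (P : Set M)
    (N : ∀ p : M, Submodule ℝ (TangentSpace p)) : Prop :=
  ∀ p, ∀ hpP : p ∈ P, ∃ κ : SubbundleChart P N, ∃ hp : p ∈ κ.chart.map.source,
    IsLocalDiffeoAt (fun q => η (κ.param q))
      (⟨κ.chart.map p, (κ.isSliceChart.mem_iff p hp).1 hpP⟩, 0)

end NormalBundle

/-- `d` is a metric which induces the given topology. -/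
structure IsCompatibleMetric {X : Type u} [TopologicalSpace X] (d : X → X → ℝ) : Prop where
  self : ∀ x, d x x = 0
  eq_of_eq_zero : ∀ x y, d x y = 0 → x = y
  comm : ∀ x y, d x y = d y x
  triangle : ∀ x y z, d x z ≤ d x y + d y z
  isOpen_iff : ∀ s : Set X, IsOpen s ↔ ∀ x ∈ s, ∃ ε > 0, ∀ y, d x y < ε → y ∈ s

section Groups

open MulAction

/-- A Lie group modeled on a locally convex space: the group operations are smooth. -/
class IsLieGroup (G : Type u) [Group G] [TopologicalSpace G] [Manifold G] : Prop where
  smooth_mul : SmoothOn (fun z : G × G => z.1 * z.2) univ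
  smooth_inv : SmoothOn (fun g : G => g⁻¹) univ

/-- `χ` is a smooth section of `G → G ⧸ H` over the open set `U`. -/
structure IsLocalSection {G : Type u} [Group G] [TopologicalSpace G] [Manifold G]
    {H : Subgroup G} [Manifold (G ⧸ H)] (χ : G ⧸ H → G) (U : Set (G ⧸ H)) : Prop where
  isOpen : IsOpen U
  smoothOn : SmoothOn χ U
  mk_eq : ∀ q ∈ U, (χ q : G ⧸ H) = q

/-- For a Lie subgroup `H` and the given manifold structure on `G ⧸ H` (which carries the quotient
topology), the projection `G → G ⧸ H` is a smooth principal `H`-bundle: it is smooth, and around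
every point there is a smooth local section which defines an equivariant local trivialization. -/
structure IsPrincipalBundle {G : Type u} [Group G] [TopologicalSpace G] [Manifold G]
    (H : Subgroup G) [IsSubmanifold (H : Set G)] [Manifold (G ⧸ H)] : Prop where
  smooth_mk : SmoothOn (fun g : G => (g : G ⧸ H)) univ
  locally_trivial : ∀ q : G ⧸ H, ∃ U χ, q ∈ U ∧ IsLocalSection χ U ∧
    IsDiffeoOn (fun z : (G ⧸ H) × (H : Set G) => χ z.1 * (z.2 : G)) (U ×ˢ univ)
      {g : G | (g : G ⧸ H) ∈ U}

variable (G : Type u) {M : Type v} [Group G] [TopologicalSpace G] [Manifold G]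
  [TopologicalSpace M] [Manifold M] [MulAction G M]

variable (M) in
/-- The action of `G` on `M` is smooth. -/
def IsSmoothAction : Prop :=
  SmoothOn (fun z : G × M => z.1 • z.2) univ

variable (M) in
/-- The action of `G` on `M` is proper: the preimages of compact sets under
`G × M → M × M, (g, p) ↦ (g • p, p)` are compact. -/
def IsProperAction : Prop :=
  ∀ K : Set (M × M), IsCompact K → IsCompact ((fun z : G × M => (z.1 • z.2, z.2)) ⁻¹' K)

/-- The bijection from `G ⧸ G_m` to the orbit of `m` is a diffeomorphism. -/
def IsOrbitMapDiffeo (m : M) [Manifold (G ⧸ stabilizer G m)] [IsSubmanifold (orbit G m)] : Prop :=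
  IsDiffeoOn (fun q : G ⧸ stabilizer G m => (orbitEquivQuotientStabilizer G m).symm q) univ univ

/-- `S` is a slice at `m`. -/
structure IsSlice (m : M) (S : Set M) : Prop where
  [isSubmanifold : IsSubmanifold S]
  mem : m ∈ S
  smul_mem : ∀ g ∈ stabilizer G m, ∀ s ∈ S, g • s ∈ S
  mem_stabilizer : ∀ g : G, ∀ s ∈ S, g • s ∈ S → g ∈ stabilizer G m
  locally_product : ∃ (_ : IsSubmanifold (stabilizer G m : Set G))
    (_ : Manifold (G ⧸ stabilizer G m)), IsPrincipalBundle (stabilizer G m) ∧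
      ∃ U χ, ((1 : G) : G ⧸ stabilizer G m) ∈ U ∧ IsLocalSection χ U ∧
        ∃ V : Set M, m ∈ V ∧
          IsDiffeoOn (fun z : (G ⧸ stabilizer G m) × S => χ z.1 • (z.2 : M)) (U ×ˢ univ) V
  isClosed_partial : IsClosed {s : S | ∃ a : G,
    stabilizer G (s : M) = (stabilizer G m).map (MulAut.conj a).toMonoidHom}
  isSubmanifold_partial : IsSubmanifold {s : S | ∃ a : G,
    stabilizer G (s : M) = (stabilizer G m).map (MulAut.conj a).toMonoidHom}

/-- `S` is a linear slice at `m`. -/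
structure IsLinearSlice (m : M) (S : Set M) : Prop extends IsSlice G m S where
  linear : ∃ (X : LCSpace.{v}) (τ : Representation ℝ (stabilizer G m) X) (Ω : Set X) (ι : X → S),
    (Continuous fun z : stabilizer G m × X => τ z.1 z.2) ∧
    (0 : X) ∈ Ω ∧ (∀ h, ∀ x ∈ Ω, τ h x ∈ Ω) ∧ IsDiffeoOn ι Ω univ ∧ (ι 0 : M) = m ∧
    ∀ h, ∀ x ∈ Ω, (ι (τ h x) : M) = (h : G) • (ι x : M)

end Groups

end LC

end

/-! A tube around the orbit is built by transporting one normal space along the orbit. Near the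
identity coset take a smooth local section `χ` of `G → G/G_m` with `χ([1]) = 1`. Since the orbit is
diffeomorphic to `G/G_m`, a slice chart of the orbit gives coordinates `ξ` on `G/G_m`
(`IsOrbitMapDiffeo.exists_param`). Moving vectors of `N_m` by `χ` then trivializes the normal bundle
near `m` (`SubbundleChart.exists_frame`). Composed with the adapted local addition, this gives a
local diffeomorphism `Ψ` at `(ξ [1], 0)`, and equivariance of `η` turns it into `Ψ (ξ q, v) = χ q •
η v` for `v` in the domain of `η`. Adaptedness thus takes the place of an inverse function theorem
on `M`.

The slice is the image under `Ψ` of `{ξ [1]} × Ω`, where `Ω` is a small `ρ_m`-ball in `N_m`. It is a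
submanifold because `Ψ` straightens it. Invariance of `ρ` makes `Ω` stable under the isotropy
representation, and equivariance of `η` makes the parametrization of the slice equivariant.

Suppose `g • s = s'` with both points in the slice. Invariance of `d` gives `d(m, g • m) ≤ d(m, s')
+ d(s, m)`, so `g • m` is close to `m`, and `[g]` is close to `[1]` because the orbit map is a
homeomorphism. Write `g = χ([g]) h` with `h ∈ G_m`. Then `h • s` lies again in the slice, and
injectivity of `Ψ` forces `[g] = [1]`. These arguments are collected in `isLinearSlice_of_tube`.

In particular `G_s ≤ G_m` on the slice. If `G_s` is conjugate to `G_m`, it is a conjugate of `G_m`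
inside `G_m`, and such a conjugate is all of `G_m` (`IsSubmanifold.map_conj_eq`). So the partial
slice corresponds to the fixed vectors of the representation, a closed linear subspace. The group
lemma rests on compactness of `G_m`, which comes from properness. A compact Lie subgroup has a
finite-dimensional model space, so the classical inverse function theorem shows that an injective
conjugation `H → H` is open at `1`. It therefore maps the identity component onto itself, and
comparing indices gives surjectivity. -/

namespace LC

universe u v w

set_option linter.unusedSectionVars false

/-! ### Smooth maps between locally convex spaces. -/

section SmoothMaps

variable {E : LCSpace.{u}} {F : LCSpace.{v}} {D : LCSpace.{w}}

theorem IsSmooth.continuousOn {f : E → F} {U : Set E} (h : IsSmooth f U) : ContinuousOn f U :=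
  h 0

theorem IsSmooth.mono {f : E → F} {U V : Set E} (h : IsSmooth f U) (hV : V ⊆ U) :
    IsSmooth f V := fun n => (h n).mono hV

theorem IsSmooth.congr {f g : E → F} {U : Set E} (h : IsSmooth f U) (hU : IsOpen U)
    (hfg : EqOn f g U) : IsSmooth g U := fun n => (h n).congr hU hfg

theorem IsSmooth.comp {g : E → F} {V : Set E} (hV : IsOpen V) (hg : IsSmooth g V) {f : D → E}
    {U : Set D} (hU : IsOpen U) (hf : IsSmooth f U) (hUV : MapsTo f U V) :
    IsSmooth (fun z => g (f z)) U := fun n => (hg n).comp hV hU (hf n) hUV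

theorem IsSmooth.prodMk {f : E → F} {g : E → D} {U : Set E} (hU : IsOpen U)
    (hf : IsSmooth f U) (hg : IsSmooth g U) :
    IsSmooth (F := F × D) (fun x => (f x, g x)) U := fun n => (hf n).prodMk hU (hg n)

theorem IsSmooth.of_locally {f : E → F} {U : Set E}
    (h : ∀ x ∈ U, ∃ V, IsOpen V ∧ x ∈ V ∧ IsSmooth f V) : IsSmooth f U := fun n =>
  IsCn.of_locally fun x hx => by
    obtain ⟨V, h1, h2, h3⟩ := h x hx
    exact ⟨V, h1, h2, h3 n⟩

theorem isSmooth_clm (L : E →L[ℝ] F) (U : Set E) : IsSmooth L U := fun n => isCn_clm n L U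

theorem HasDirDeriv.const (x v : E) (y : F) : HasDirDeriv (fun _ : E => y) x v 0 := by
  simp [HasDirDeriv]

theorem isSmooth_const (y : F) (U : Set E) : IsSmooth (fun _ : E => y) U := by
  intro n
  cases n with
  | zero => exact continuousOn_const
  | succ n =>
    refine ⟨continuousOn_const, fun x _ v => (HasDirDeriv.const x v y).dirDeriv, ?_⟩
    have : (fun p : E × E => dirDeriv (fun _ : E => y) p.1 p.2) = (0 : E × E →L[ℝ] F) := by
      funext p
      exact (HasDirDeriv.const p.1 p.2 y).eq
    rw [this]
    exact isCn_clm n _ _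

theorem IsSmooth.dirDeriv {f : E → F} {U : Set E} (h : IsSmooth f U) :
    IsSmooth (E := E × E) (fun p => dirDeriv f p.1 p.2) (U ×ˢ univ) :=
  fun n => (h (n + 1)).2.2

end SmoothMaps

/-! ### Smooth maps between manifolds: independence of charts, composition, products. -/

section SmoothOn

variable {M : Type u} [TopologicalSpace M] [Manifold M] {N : Type v} [TopologicalSpace N]
  [Manifold N] {P : Type w} [TopologicalSpace P] [Manifold P]

theorem SmoothOn.continuousOn {f : M → N} {W : Set M} (h : SmoothOn f W) : ContinuousOn f W := h.1

theorem isOpen_chartDomain {f : M → N} {W : Set M} (hW : IsOpen W) (hf : ContinuousOn f W)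
    (c : Chart M) (c' : Chart N) :
    IsOpen (c.map.target ∩ c.map.symm ⁻¹' (W ∩ f ⁻¹' c'.map.source)) :=
  c.map.isOpen_inter_preimage_symm (hf.isOpen_inter_preimage hW c'.map.open_source)

/-- A smooth map is smooth with respect to all compatible charts. -/
theorem SmoothOn.isSmooth {f : M → N} {W : Set M} (hW : IsOpen W) (h : SmoothOn f W)
    {c : Chart M} (hc : c ∈ maximalAtlas M) {c' : Chart N} (hc' : c' ∈ maximalAtlas N) :
    IsSmooth (fun x => c'.map (f (c.map.symm x)))
      (c.map.target ∩ c.map.symm ⁻¹' (W ∩ f ⁻¹' c'.map.source)) := by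
  -- Near `x` the representation in `c`, `c'` factors through atlas charts `b`, `b'`: change from
  -- `c` to `b`, then `f` in `b`, `b'`, then change from `b'` to `c'`.
  refine IsSmooth.of_locally fun x hx => ?_
  obtain ⟨b, hb, hxb⟩ := Manifold.exists_chart (c.map.symm x)
  obtain ⟨b', hb', hxb'⟩ := Manifold.exists_chart (f (c.map.symm x))
  have h1 := h.2 b hb b' hb'
  have h2 := (hc b hb).1
  have h3 := (hc' b' hb').2
  have ho1 := isOpen_chartDomain hW h.1 b b'
  set V := (c.map.target ∩ c.map.symm ⁻¹' (W ∩ f ⁻¹' c'.map.source)) ∩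
    (c.map.target ∩ c.map.symm ⁻¹' (W ∩ f ⁻¹' b'.map.source)) ∩ c.overlap b with hV
  have hVo : IsOpen V := ((isOpen_chartDomain hW h.1 c c').inter
    (isOpen_chartDomain hW h.1 c b')).inter (c.isOpen_overlap b)
  refine ⟨V, hVo, ⟨⟨hx, hx.1, hx.2.1, hxb'⟩, hx.1, hxb⟩, ?_⟩
  have h4 : IsSmooth (fun y => b'.map (f (b.map.symm (c.change b y)))) V := by
    refine h1.comp ho1 hVo (h2.mono inter_subset_right) ?_
    rintro y ⟨⟨⟨-, -, -⟩, -, hy1, hy2⟩, -, hy3⟩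
    have hy3 : c.map.symm y ∈ b.map.source := hy3
    refine ⟨b.map.map_source hy3, ?_⟩
    simp only [Chart.change, mem_preimage, b.map.left_inv hy3]
    exact ⟨hy1, hy2⟩
  refine (h3.comp (b'.isOpen_overlap c') hVo h4 ?_).congr hVo ?_
  · rintro y ⟨⟨⟨-, -, hy0⟩, -, hy1, hy2⟩, -, hy3⟩
    have hy3 : c.map.symm y ∈ b.map.source := hy3
    have hy2 : f (c.map.symm y) ∈ b'.map.source := hy2
    simp only [Chart.change, b.map.left_inv hy3]
    refine ⟨b'.map.map_source hy2, ?_⟩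
    simp only [mem_preimage, b'.map.left_inv hy2]
    exact hy0
  · rintro y ⟨⟨⟨-, -, hy0⟩, -, hy1, hy2⟩, -, hy3⟩
    have hy3 : c.map.symm y ∈ b.map.source := hy3
    have hy2 : f (c.map.symm y) ∈ b'.map.source := hy2
    simp only [Chart.change, b.map.left_inv hy3, b'.map.left_inv hy2]

/-- Smoothness can be checked in suitable compatible charts around every point. -/
theorem SmoothOn.of_charts {f : M → N} {W : Set M}
    (h : ∀ p ∈ W, ∃ c ∈ maximalAtlas M, ∃ c' ∈ maximalAtlas N, ∃ V : Set M, IsOpen V ∧ p ∈ V ∧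
      V ⊆ c.map.source ∧ MapsTo f V c'.map.source ∧
      IsSmooth (fun x => c'.map (f (c.map.symm x))) (c.map.target ∩ c.map.symm ⁻¹' V)) :
    SmoothOn f W := by
  -- Continuity of `f` is not assumed; it is recovered from the `C^0` part of the local
  -- representation, conjugated back by the charts.
  have hcont : ∀ {c : Chart M} {c' : Chart N} {V : Set M}, V ⊆ c.map.source →
      MapsTo f V c'.map.source → IsSmooth (fun x => c'.map (f (c.map.symm x)))
        (c.map.target ∩ c.map.symm ⁻¹' V) → ContinuousOn f V := by
    intro c c' V hVc hVc' hf
    have h1 : ContinuousOn (fun q => c'.map.symm (c'.map (f (c.map.symm (c.map q))))) V := by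
      refine c'.map.continuousOn_symm.comp (hf.continuousOn.comp
        (c.map.continuousOn.mono hVc) ?_) ?_
      · intro q hq
        refine ⟨c.map.map_source (hVc hq), ?_⟩
        simpa only [mem_preimage, c.map.left_inv (hVc hq)] using hq
      · intro q hq
        simp only [c.map.left_inv (hVc hq)]
        exact c'.map.map_source (hVc' hq)
    refine h1.congr fun q hq => ?_
    simp only [c.map.left_inv (hVc hq), c'.map.left_inv (hVc' hq)]
  refine ⟨fun p hp => ?_, fun b hb b' hb' => IsSmooth.of_locally fun x hx => ?_⟩
  · obtain ⟨c, -, c', -, V, hV, hpV, hVc, hVc', hf⟩ := h p hp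
    exact ((hcont hVc hVc' hf).continuousAt (hV.mem_nhds hpV)).continuousWithinAt
  obtain ⟨c, hc, c', hc', V, hV, hpV, hVc, hVc', hf⟩ := h (b.map.symm x) hx.2.1
  have ho : IsOpen (c.map.target ∩ c.map.symm ⁻¹' V) := c.map.isOpen_inter_preimage_symm hV
  have hfV : ContinuousOn f V := hcont hVc hVc' hf
  set V' := b.map.target ∩ b.map.symm ⁻¹' (V ∩ f ⁻¹' b'.map.source) with hV'
  have hV'o : IsOpen V' := isOpen_chartDomain hV hfV b b'
  refine ⟨V', hV'o, ⟨hx.1, hpV, hx.2.2⟩, ?_⟩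
  have h1 : IsSmooth (b.change c) V' := (hc b hb).2.mono fun y hy => ⟨hy.1, hVc hy.2.1⟩
  have h2 : IsSmooth (fun y => c'.map (f (c.map.symm (b.change c y)))) V' := by
    refine hf.comp ho hV'o h1 fun y hy => ⟨c.map.map_source (hVc hy.2.1), ?_⟩
    simpa only [mem_preimage, Chart.change, c.map.left_inv (hVc hy.2.1)] using hy.2.1
  refine ((hc' b' hb').1.comp (c'.isOpen_overlap b') hV'o h2 ?_).congr hV'o ?_
  · intro y hy
    simp only [Chart.change, c.map.left_inv (hVc hy.2.1)]
    refine ⟨c'.map.map_source (hVc' hy.2.1), ?_⟩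
    simpa only [mem_preimage, c'.map.left_inv (hVc' hy.2.1)] using hy.2.2
  · intro y hy
    simp only [Chart.change, c.map.left_inv (hVc hy.2.1), c'.map.left_inv (hVc' hy.2.1)]

theorem SmoothOn.mono {f : M → N} {W V : Set M} (h : SmoothOn f W) (hVW : V ⊆ W) :
    SmoothOn f V :=
  ⟨h.1.mono hVW, fun c hc c' hc' => (h.2 c hc c' hc').mono fun _ hx => ⟨hx.1, hVW hx.2.1, hx.2.2⟩⟩

/-- The charts and the open set in which a smooth map is represented around a point. -/
theorem SmoothOn.exists_charts {f : M → N} {W : Set M} (hW : IsOpen W) (h : SmoothOn f W)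
    {p : M} (hp : p ∈ W) {c : Chart M} (hc : c ∈ maximalAtlas M) (hpc : p ∈ c.map.source)
    {c' : Chart N} (hc' : c' ∈ maximalAtlas N) (hpc' : f p ∈ c'.map.source) :
    ∃ V, IsOpen V ∧ p ∈ V ∧ V ⊆ c.map.source ∧ V ⊆ W ∧ MapsTo f V c'.map.source ∧
      IsSmooth (fun x => c'.map (f (c.map.symm x))) (c.map.target ∩ c.map.symm ⁻¹' V) := by
  refine ⟨(W ∩ f ⁻¹' c'.map.source) ∩ c.map.source,
    (h.1.isOpen_inter_preimage hW c'.map.open_source).inter c.map.open_source,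
    ⟨⟨hp, hpc'⟩, hpc⟩, inter_subset_right, fun x hx => hx.1.1, fun x hx => hx.1.2, ?_⟩
  exact (h.isSmooth hW hc hc').mono fun x hx => ⟨hx.1, hx.2.1⟩

theorem SmoothOn.congr {f g : M → N} {W : Set M} (hW : IsOpen W) (h : SmoothOn f W)
    (hfg : EqOn f g W) : SmoothOn g W := by
  refine ⟨h.1.congr hfg.symm, fun c hc c' hc' => ?_⟩
  have e : c.map.target ∩ c.map.symm ⁻¹' (W ∩ g ⁻¹' c'.map.source) =
      c.map.target ∩ c.map.symm ⁻¹' (W ∩ f ⁻¹' c'.map.source) := by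
    ext x
    simp only [mem_inter_iff, mem_preimage]
    refine and_congr_right fun _ => and_congr_right fun hx => ?_
    rw [hfg hx]
  rw [e]
  refine (h.2 c hc c' hc').congr (isOpen_chartDomain hW h.1 c c') fun x hx => ?_
  simp only [hfg hx.2.1]

theorem SmoothOn.comp {g : N → P} {V : Set N} (hV : IsOpen V) (hg : SmoothOn g V) {f : M → N}
    {W : Set M} (hW : IsOpen W) (hf : SmoothOn f W) (hWV : MapsTo f W V) :
    SmoothOn (fun p => g (f p)) W := by
  refine SmoothOn.of_charts fun p hp => ?_
  have ha := atlas_subset_maximalAtlas (chartAt_mem p)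
  have hb := atlas_subset_maximalAtlas (chartAt_mem (f p))
  have hc := atlas_subset_maximalAtlas (chartAt_mem (g (f p)))
  set a := chartAt p
  set b := chartAt (f p)
  set c := chartAt (g (f p))
  obtain ⟨V', hV', hpV', hV'b, hV'V, hV'c, h1⟩ := hg.exists_charts hV (hWV hp) hb
    (mem_chartAt_source _) hc (mem_chartAt_source _)
  have hW' : IsOpen (W ∩ f ⁻¹' V') := hf.1.isOpen_inter_preimage hW hV'
  have hf' := hf.mono (V := W ∩ f ⁻¹' V') inter_subset_left
  obtain ⟨W'', hW'', hpW'', hWa, hWW', hWb, h2⟩ := hf'.exists_charts hW' ⟨hp, hpV'⟩ ha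
    (mem_chartAt_source _) hb (mem_chartAt_source _)
  refine ⟨a, ha, c, hc, W'', hW'', hpW'', hWa, fun q hq => hV'c (hWW' hq).2, ?_⟩
  have ho := a.map.isOpen_inter_preimage_symm hW''
  refine (h1.comp (b.map.isOpen_inter_preimage_symm hV') ho h2 ?_).congr ho ?_
  · intro x hx
    refine ⟨b.map.map_source (hWb hx.2), ?_⟩
    simp only [mem_preimage, b.map.left_inv (hWb hx.2)]
    exact (hWW' hx.2).2
  · intro x hx
    simp only [b.map.left_inv (hWb hx.2)]

theorem smoothOn_id (W : Set M) : SmoothOn (fun p : M => p) W :=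
  ⟨continuousOn_id, fun c hc c' hc' => (Manifold.smooth_change c hc c' hc').mono
    fun _ hx => ⟨hx.1, hx.2.2⟩⟩

theorem smoothOn_const (q : N) (W : Set M) : SmoothOn (fun _ : M => q) W :=
  ⟨continuousOn_const, fun _ _ c' _ => isSmooth_const (c'.map q) _⟩

theorem Chart.prod_mem_maximalAtlas {c : Chart M} (hc : c ∈ maximalAtlas M) {d : Chart N}
    (hd : d ∈ maximalAtlas N) : c.prod d ∈ maximalAtlas (M × N) := by
  have key : ∀ {a b : Chart M} {a' b' : Chart N}, IsSmooth (a.change b) (a.overlap b) →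
      IsSmooth (a'.change b') (a'.overlap b') →
      IsSmooth ((a.prod a').change (b.prod b')) ((a.prod a').overlap (b.prod b')) := by
    intro a b a' b' h h' n
    have ho : IsOpen ((a.overlap b) ×ˢ (a'.overlap b')) :=
      (a.isOpen_overlap b).prod (a'.isOpen_overlap b')
    have h1 := ((h n).comp_clm (ContinuousLinearMap.fst ℝ a.space a'.space)).mono
      (V := (a.overlap b) ×ˢ (a'.overlap b')) fun p hp => hp.1
    have h2 := ((h' n).comp_clm (ContinuousLinearMap.snd ℝ a.space a'.space)).mono
      (V := (a.overlap b) ×ˢ (a'.overlap b')) fun p hp => hp.2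
    refine IsCn.mono (h1.prodMk ho h2) ?_
    rintro p ⟨⟨h1, h2⟩, ⟨h3, h4⟩⟩
    exact ⟨⟨h1, h3⟩, ⟨h2, h4⟩⟩
  rintro _ ⟨a, ha, a', ha', rfl⟩
  exact ⟨key (hc a ha).1 (hd a' ha').1, key (hc a ha).2 (hd a' ha').2⟩

theorem smoothOn_fst (W : Set (M × N)) : SmoothOn (fun z : M × N => z.1) W := by
  refine ⟨continuous_fst.continuousOn, ?_⟩
  rintro _ ⟨c, hc, d, hd, rfl⟩ c' hc' n
  exact ((Manifold.smooth_change c hc c' hc' n).comp_clm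
    (ContinuousLinearMap.fst ℝ c.space d.space)).mono fun x hx => ⟨hx.1.1, hx.2.2⟩

theorem smoothOn_snd (W : Set (M × N)) : SmoothOn (fun z : M × N => z.2) W := by
  refine ⟨continuous_snd.continuousOn, ?_⟩
  rintro _ ⟨c, hc, d, hd, rfl⟩ c' hc' n
  exact ((Manifold.smooth_change d hd c' hc' n).comp_clm
    (ContinuousLinearMap.snd ℝ c.space d.space)).mono fun x hx => ⟨hx.1.2, hx.2.2⟩

theorem SmoothOn.prodMk {f : M → N} {g : M → P} {W : Set M} (hW : IsOpen W) (hf : SmoothOn f W)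
    (hg : SmoothOn g W) : SmoothOn (fun x => (f x, g x)) W := by
  refine ⟨hf.1.prodMk hg.1, ?_⟩
  rintro c hc _ ⟨a, ha, b, hb, rfl⟩
  have ho := isOpen_chartDomain hW (hf.1.prodMk hg.1) c (a.prod b)
  exact IsSmooth.prodMk ho ((hf.2 c hc a ha).mono fun x hx => ⟨hx.1, hx.2.1, hx.2.2.1⟩)
    ((hg.2 c hc b hb).mono fun x hx => ⟨hx.1, hx.2.1, hx.2.2.2⟩)

theorem SmoothOn.snd {f : M → N × P} {W : Set M} (hW : IsOpen W) (hf : SmoothOn f W) :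
    SmoothOn (fun x => (f x).2) W :=
  (smoothOn_snd univ).comp isOpen_univ hW hf fun _ _ => trivial

end SmoothOn

/-! ### Locally convex spaces as manifolds, and charts as smooth maps. -/

section ModelSpaces

variable {M : Type u} [TopologicalSpace M] [Manifold M]

/-- The identity of a locally convex space, as a chart. -/
noncomputable def LCSpace.chart (E : LCSpace.{u}) : Chart E := ⟨E, OpenPartialHomeomorph.refl E⟩

theorem LCSpace.chart_mem (E : LCSpace.{u}) : E.chart ∈ maximalAtlas E :=
  atlas_subset_maximalAtlas rfl

theorem smoothOn_iff_isSmooth {E : LCSpace.{u}} {F : LCSpace.{v}} {f : E → F} {W : Set E}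
    : SmoothOn f W ↔ IsSmooth f W := by
  constructor
  · intro h
    exact (h.2 E.chart rfl F.chart rfl).mono fun x hx => ⟨trivial, hx, trivial⟩
  · intro h
    refine ⟨h.continuousOn, ?_⟩
    rintro _ rfl _ rfl
    exact h.mono fun x hx => hx.2.1

theorem smoothOn_prod_iff_isSmooth {E : LCSpace.{u}} {E' : LCSpace.{v}} {F : LCSpace.{w}}
    {f : E × E' → F} {W : Set (E × E')} :
    SmoothOn f W ↔ IsSmooth f W := by
  constructor
  · intro h
    exact (h.2 (E.chart.prod E'.chart) ⟨_, rfl, _, rfl, rfl⟩ F.chart rfl).mono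
      fun x hx => ⟨⟨trivial, trivial⟩, hx, trivial⟩
  · intro h
    refine ⟨h 0, ?_⟩
    rintro _ ⟨_, rfl, _, rfl, rfl⟩ _ rfl
    exact h.mono (E := E.prod E') fun x hx => hx.2.1

theorem Chart.smoothOn_map {c : Chart M} (hc : c ∈ maximalAtlas M) :
    SmoothOn c.map c.map.source := by
  refine SmoothOn.of_charts fun p hp => ⟨c, hc, c.space.chart, c.space.chart_mem, c.map.source,
    c.map.open_source, hp, le_rfl, fun _ _ => trivial, ?_⟩
  refine IsSmooth.congr (isSmooth_clm (ContinuousLinearMap.id ℝ c.space) _)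
    (c.map.isOpen_inter_preimage_symm c.map.open_source) ?_
  intro x hx
  exact (c.map.right_inv hx.1).symm

theorem Chart.smoothOn_symm {c : Chart M} (hc : c ∈ maximalAtlas M) :
    SmoothOn c.map.symm c.map.target := by
  refine SmoothOn.of_charts fun x hx => ⟨c.space.chart, c.space.chart_mem, c, hc, c.map.target,
    c.map.open_target, hx, fun _ _ => trivial, fun y hy => c.map.map_target hy, ?_⟩
  refine IsSmooth.congr (isSmooth_clm (ContinuousLinearMap.id ℝ c.space) _)
    (isOpen_univ.inter (c.map.open_target.preimage continuous_id)) ?_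
  intro y hy
  exact (c.map.right_inv hy.2).symm

end ModelSpaces

/-! ### Smooth maps out of and into submanifolds and closed subspaces. -/

section Submanifolds

variable {M : Type u} [TopologicalSpace M] [Manifold M] {N : Type v} [TopologicalSpace N]
  [Manifold N]

/-- The inclusion of a submanifold is smooth. -/
theorem smoothOn_subtypeVal (S : Set M) [IsSubmanifold S] (W : Set S) :
    SmoothOn (fun s : S => (s : M)) W := by
  refine SmoothOn.mono (W := univ) (SmoothOn.of_charts fun p _ => ?_) (subset_univ _)
  obtain ⟨c, hp, F, h⟩ := IsSubmanifold.exists_sliceChart p.1 p.2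
  refine ⟨h.restrict p, atlas_subset_maximalAtlas ⟨c, F, h, p, rfl⟩, c, h.mem_maximalAtlas,
    Subtype.val ⁻¹' c.map.source, c.map.open_source.preimage continuous_subtype_val, hp, le_rfl,
    fun _ hs => hs, ?_⟩
  refine IsSmooth.congr (E := c.space.sub F) (isSmooth_clm F.subtypeL _)
    ((h.restrict p).map.isOpen_inter_preimage_symm
      (c.map.open_source.preimage continuous_subtype_val)) ?_
  intro x hx
  have hx' : x.val ∈ c.map.target := hx.1
  exact ((congrArg c.map (h.homeo_symm_apply p hx')).trans (c.map.right_inv hx')).symm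

/-- A map into a submanifold is smooth if it is smooth as a map into the ambient manifold. -/
theorem SmoothOn.codRestrict {S : Set M} [IsSubmanifold S] {f : N → S} {W : Set N}
    (hW : IsOpen W) (h : SmoothOn (fun x => (f x : M)) W) : SmoothOn f W := by
  have hcont : ContinuousOn f W := IsInducing.subtypeVal.continuousOn_iff.2 h.1
  refine ⟨hcont, ?_⟩
  rintro b hb _ ⟨c, F, hF, s, rfl⟩ n
  have ho := isOpen_chartDomain hW hcont b (hF.restrict s)
  refine IsCn.of_isClosedEmbedding_comp F.subtypeL hF.isClosed.isClosedEmbedding_subtypeVal ho ?_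
  have h1 := h.isSmooth hW (atlas_subset_maximalAtlas hb) hF.mem_maximalAtlas n
  refine (h1.mono (V := b.map.target ∩ b.map.symm ⁻¹' (W ∩ f ⁻¹' (hF.restrict s).map.source))
    fun x hx => ⟨hx.1, hx.2.1, hx.2.2⟩).congr ho fun x hx => ?_
  exact (hF.homeo_apply s (p := f (b.map.symm x)) hx.2.2).symm

/-- The manifold `E.sub F` has its identity as only atlas chart, so this is separate from
`SmoothOn.codRestrict`. Closedness keeps limits of difference quotients inside `F`. -/
theorem smoothOn_subspace_iff {E : LCSpace.{v}} {F : Submodule ℝ E} (hF : IsClosed (F : Set E))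
    {f : M → E.sub F} {W : Set M} (hW : IsOpen W) :
    SmoothOn f W ↔ SmoothOn (N := E) (fun x => F.subtypeL (f x)) W := by
  constructor
  · intro h
    exact (smoothOn_iff_isSmooth.2 (isSmooth_clm (E := E.sub F) F.subtypeL univ)).comp
      isOpen_univ hW h fun _ _ => trivial
  · intro h
    have hcont : ContinuousOn f W := IsInducing.subtypeVal.continuousOn_iff.2 h.1
    refine ⟨hcont, ?_⟩
    rintro b hb _ rfl n
    have ho := isOpen_chartDomain hW hcont b (E.sub F).chart
    exact IsCn.of_isClosedEmbedding_comp F.subtypeL hF.isClosedEmbedding_subtypeVal ho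
      ((h.2 b hb E.chart rfl n).mono fun x hx => ⟨hx.1, hx.2.1, trivial⟩)

end Submanifolds

/-! ### Diffeomorphisms between open sets, and the charts that they define. -/

section Diffeo

variable {M : Type u} [TopologicalSpace M] [Manifold M] {N : Type v} [TopologicalSpace N]
  [Manifold N] {P : Type w} [TopologicalSpace P] [Manifold P]

theorem IsDiffeoOn.of_invOn {f : M → N} {g : N → M} {A : Set M} {B : Set N} (hA : IsOpen A)
    (hB : IsOpen B) (hf : SmoothOn f A) (hg : SmoothOn g B) (hAB : MapsTo f A B)
    (hBA : MapsTo g B A) (hfg : InvOn g f A B) : IsDiffeoOn f A B :=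
  ⟨hA, hB, hfg.bijOn hAB hBA, hf, g, hfg, hg⟩

theorem IsDiffeoOn.exists_inv {f : M → N} {A : Set M} {B : Set N} (h : IsDiffeoOn f A B) :
    ∃ g : N → M, InvOn g f A B ∧ SmoothOn g B ∧ MapsTo g B A := by
  obtain ⟨g, hg, hgs⟩ := h.smoothOn_inv
  refine ⟨g, hg, hgs, fun y hy => ?_⟩
  obtain ⟨x, hx, rfl⟩ := h.bijOn.surjOn hy
  rwa [hg.1 hx]

theorem IsDiffeoOn.comp {g : N → P} {f : M → N} {A : Set M} {B : Set N} {C : Set P}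
    (hg : IsDiffeoOn g B C) (hf : IsDiffeoOn f A B) : IsDiffeoOn (fun x => g (f x)) A C := by
  obtain ⟨f', hf1, hf2, hf3⟩ := hf.exists_inv
  obtain ⟨g', hg1, hg2, hg3⟩ := hg.exists_inv
  refine IsDiffeoOn.of_invOn (g := fun z => f' (g' z)) hf.isOpen_source hg.isOpen_target
    (hg.smoothOn.comp hf.isOpen_target hf.isOpen_source hf.smoothOn hf.bijOn.mapsTo)
    (hf2.comp hf.isOpen_target hg.isOpen_target hg2 hg3)
    (hg.bijOn.mapsTo.comp hf.bijOn.mapsTo) (hf3.comp hg3) ⟨fun x hx => ?_, fun z hz => ?_⟩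
  · exact (congrArg f' (hg1.1 (hf.bijOn.mapsTo hx))).trans (hf1.1 hx)
  · exact (congrArg g (hf1.2 (hg3 hz))).trans (hg1.2 hz)

theorem IsDiffeoOn.restrict_image {f : M → N} {A : Set M} {B : Set N} (h : IsDiffeoOn f A B)
    {A' : Set M} (hA' : IsOpen A') (hA : A' ⊆ A) : IsDiffeoOn f A' (f '' A') := by
  obtain ⟨g, hg, hgs, hgm⟩ := h.exists_inv
  have e : f '' A' = B ∩ g ⁻¹' A' := by
    ext y
    constructor
    · rintro ⟨x, hx, rfl⟩
      refine ⟨h.bijOn.mapsTo (hA hx), ?_⟩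
      rwa [mem_preimage, hg.1 (hA hx)]
    · rintro ⟨hy, hy'⟩
      exact ⟨g y, hy', hg.2 hy⟩
  have ho : IsOpen (f '' A') := e ▸ hgs.1.isOpen_inter_preimage h.isOpen_target hA'
  refine IsDiffeoOn.of_invOn (g := g) hA' ho (h.smoothOn.mono hA)
    (hgs.mono (e ▸ inter_subset_left)) (mapsTo_image f A') ?_ ⟨hg.1.mono hA, ?_⟩
  · rintro _ ⟨x, hx, rfl⟩
    rwa [hg.1 (hA hx)]
  · rintro _ ⟨x, hx, rfl⟩
    rw [hg.1 (hA hx)]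

theorem IsDiffeoOn.restrict_preimage {f : M → N} {A : Set M} {B : Set N} (h : IsDiffeoOn f A B)
    {B' : Set N} (hB' : IsOpen B') (hB : B' ⊆ B) : IsDiffeoOn f (A ∩ f ⁻¹' B') B' := by
  have := h.restrict_image (h.smoothOn.1.isOpen_inter_preimage h.isOpen_source hB')
    inter_subset_left
  rwa [image_inter_preimage, h.bijOn.image_eq, inter_eq_right.2 hB] at this

theorem IsDiffeoOn.congr {f g : M → N} {A : Set M} {B : Set N} (h : IsDiffeoOn f A B)
    (hfg : EqOn f g A) : IsDiffeoOn g A B := by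
  obtain ⟨k, hk, hks, hkm⟩ := h.exists_inv
  refine IsDiffeoOn.of_invOn (g := k) h.isOpen_source h.isOpen_target
    (h.smoothOn.congr h.isOpen_source hfg) hks (h.bijOn.mapsTo.congr hfg) hkm
    ⟨fun x hx => ?_, fun y hy => ?_⟩
  · rw [← hfg hx]; exact hk.1 hx
  · rw [← hfg (hkm hy)]; exact hk.2 hy

/-- A diffeomorphism from an open subset of a locally convex space onto an open subset of a
manifold is the inverse of a compatible chart. -/
theorem IsDiffeoOn.exists_chart {E : LCSpace.{u}} {f : E → M} {A : Set E} {B : Set M}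
    (h : IsDiffeoOn f A B) : ∃ e : OpenPartialHomeomorph M E, (⟨E, e⟩ : Chart M) ∈ maximalAtlas M ∧
      e.source = B ∧ e.target = A ∧ (e.symm : E → M) = f ∧ ∀ x ∈ A, e (f x) = x := by
  obtain ⟨g, hg, hgs, hgm⟩ := h.exists_inv
  refine ⟨{ toFun := g, invFun := f, source := B, target := A, map_source' := hgm,
            map_target' := h.bijOn.mapsTo, left_inv' := hg.2, right_inv' := hg.1,
            open_source := h.isOpen_target, open_target := h.isOpen_source,
            continuousOn_toFun := hgs.1, continuousOn_invFun := h.smoothOn.1 }, fun c hc => ⟨?_, ?_⟩, rfl, rfl, rfl, hg.1⟩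
  · exact (h.smoothOn.2 E.chart rfl c hc).mono fun x hx => ⟨trivial, hx⟩
  · exact (hgs.2 c hc E.chart rfl).mono fun x hx => ⟨hx.1, hx.2, trivial⟩

theorem IsDiffeoOn.prodMap {M' : Type*} [TopologicalSpace M'] [Manifold M'] {N' : Type*}
    [TopologicalSpace N'] [Manifold N'] {f : M → N} {A : Set M} {B : Set N} {f' : M' → N'}
    {A' : Set M'} {B' : Set N'} (h : IsDiffeoOn f A B) (h' : IsDiffeoOn f' A' B') :
    IsDiffeoOn (fun z : M × M' => (f z.1, f' z.2)) (A ×ˢ A') (B ×ˢ B') := by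
  obtain ⟨g, hg, hgs, hgm⟩ := h.exists_inv
  obtain ⟨g', hg', hgs', hgm'⟩ := h'.exists_inv
  have ho := h.isOpen_source.prod h'.isOpen_source
  have ho' := h.isOpen_target.prod h'.isOpen_target
  refine IsDiffeoOn.of_invOn (g := fun z => (g z.1, g' z.2)) ho ho' ?_ ?_ ?_ ?_ ⟨?_, ?_⟩
  · exact SmoothOn.prodMk ho
      (h.smoothOn.comp h.isOpen_source ho (smoothOn_fst _) fun z hz => hz.1)
      (h'.smoothOn.comp h'.isOpen_source ho (smoothOn_snd _) fun z hz => hz.2)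
  · exact SmoothOn.prodMk ho'
      (hgs.comp h.isOpen_target ho' (smoothOn_fst _) fun z hz => hz.1)
      (hgs'.comp h'.isOpen_target ho' (smoothOn_snd _) fun z hz => hz.2)
  · exact fun z hz => ⟨h.bijOn.mapsTo hz.1, h'.bijOn.mapsTo hz.2⟩
  · exact fun z hz => ⟨hgm hz.1, hgm' hz.2⟩
  · exact fun z hz => Prod.ext (hg.1 hz.1) (hg'.1 hz.2)
  · exact fun z hz => Prod.ext (hg.2 hz.1) (hg'.2 hz.2)

theorem IsDiffeoOn.symm_of_invOn {f : M → N} {g : N → M} {A : Set M} {B : Set N}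
    (h : IsDiffeoOn f A B) (hg : InvOn g f A B) : IsDiffeoOn g B A := by
  obtain ⟨k, hk, hks, hkm⟩ := h.exists_inv
  have e : EqOn k g B := fun y hy => by
    obtain ⟨x, hx, rfl⟩ := h.bijOn.surjOn hy
    rw [hk.1 hx, hg.1 hx]
  exact (IsDiffeoOn.of_invOn (g := f) h.isOpen_target h.isOpen_source hks h.smoothOn hkm
    h.bijOn.mapsTo hk.symm).congr e

theorem Chart.isDiffeoOn_symm {c : Chart M} (hc : c ∈ maximalAtlas M) :
    IsDiffeoOn c.map.symm c.map.target c.map.source :=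
  IsDiffeoOn.of_invOn (g := c.map) c.map.open_target c.map.open_source (c.smoothOn_symm hc)
    (c.smoothOn_map hc) c.map.mapsTo_symm c.map.mapsTo
    ⟨fun _ hx => c.map.right_inv hx, fun _ hx => c.map.left_inv hx⟩

end Diffeo

/-! ### Submanifolds obtained as fibres of a product parametrization. -/

section Tube

/-- The two sides carry different atlases, the identity chart of a locally convex space and the
product of two identity charts. The comparison is needed to read a parametrization by a product as
the inverse of a chart. -/
theorem isDiffeoOn_prod (E : LCSpace.{u}) (F : LCSpace.{v}) :
    IsDiffeoOn (M := E.prod F) (N := E × F) (fun q => q) univ univ := by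
  refine IsDiffeoOn.of_invOn (M := E.prod F) (N := E × F) (g := fun q : E × F => q) isOpen_univ
    isOpen_univ ⟨continuousOn_id, ?_⟩ ?_ (mapsTo_univ _ _) (mapsTo_univ _ _)
    ⟨fun _ _ => rfl, fun _ _ => rfl⟩
  · rintro _ rfl _ ⟨_, rfl, _, rfl, rfl⟩
    exact isSmooth_clm (ContinuousLinearMap.id ℝ (E.prod F)) _
  · exact smoothOn_prod_iff_isSmooth (F := E.prod F).2
      (isSmooth_clm (ContinuousLinearMap.id ℝ (E.prod F)) _)

theorem smoothOn_add_const {E : LCSpace.{u}} (y : E) : SmoothOn (fun x : E => x + y) univ := by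
  have h : SmoothOn (fun q : E × E => q.1 + q.2) univ := smoothOn_prod_iff_isSmooth.2
    (isSmooth_clm (E := E.prod E) (ContinuousLinearMap.fst ℝ E E + ContinuousLinearMap.snd ℝ E E)
      univ)
  exact h.comp isOpen_univ isOpen_univ ((smoothOn_id univ).prodMk isOpen_univ (smoothOn_const y _))
    fun _ _ => trivial

variable {M : Type v} [TopologicalSpace M] [Manifold M]

/-- If `Ψ` is a diffeomorphism from `W × Ω` onto an open subset of `M`, the image of
`{x₁} × Ω` is a submanifold. -/
theorem IsDiffeoOn.isSubmanifold_image {F X : LCSpace.{v}} {Ψ : F × X → M} {W : Set F}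
    {Ω : Set X} {V : Set M} (h : IsDiffeoOn Ψ (W ×ˢ Ω) V) {x₁ : F} (hx₁ : x₁ ∈ W) :
    IsSubmanifold ((fun v => Ψ (x₁, v)) '' Ω) := by
  -- A slice chart must straighten the set to a linear subspace, not an affine one. Translating `x₁`
  -- to `0` turns the fibre into the kernel of the first projection.
  have hT : IsDiffeoOn (fun q : F × X => (q.1 + x₁, q.2)) univ univ := by
    refine IsDiffeoOn.of_invOn (g := fun q : F × X => (q.1 + -x₁, q.2)) isOpen_univ
      isOpen_univ ?_ ?_ (mapsTo_univ _ _) (mapsTo_univ _ _)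
      ⟨fun q _ => Prod.ext (add_neg_cancel_right _ _) rfl,
        fun q _ => Prod.ext (neg_add_cancel_right _ _) rfl⟩ <;>
    exact ((smoothOn_add_const _).comp isOpen_univ isOpen_univ (smoothOn_fst _)
      fun _ _ => trivial).prodMk isOpen_univ (smoothOn_snd _)
  have hΨ := h.comp ((hT.comp (isDiffeoOn_prod F X)).restrict_preimage h.isOpen_source
    (subset_univ _))
  obtain ⟨e, he, hes, het, hesymm, hei⟩ := hΨ.exists_chart
  refine ⟨?_⟩
  rintro _ ⟨v, hv, rfl⟩
  refine ⟨⟨_, e⟩, ?_, LinearMap.ker (LinearMap.fst ℝ F X), he, ?_, ?_⟩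
  · rw [hes]
    exact h.bijOn.mapsTo ⟨hx₁, hv⟩
  · exact (isClosed_singleton (x := (0 : F))).preimage (continuous_fst (X := F) (Y := X))
  · intro p hp
    rw [hes] at hp
    obtain ⟨⟨x, w⟩, hxw, rfl⟩ := hΨ.bijOn.surjOn hp
    have h1 : (e (Ψ (x + x₁, w)) : F × X) = (x, w) := hei (x, w) hxw
    constructor
    · rintro ⟨w', hw', hw⟩
      have h2 := h.bijOn.injOn ⟨hx₁, hw'⟩ hxw.2 hw
      have h3 : x + x₁ = x₁ := (congrArg Prod.fst h2).symm
      change (e (Ψ (x + x₁, w)) : F × X).1 = 0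
      rw [h1]
      exact add_eq_right.1 h3
    · intro hx
      change (e (Ψ (x + x₁, w)) : F × X).1 = 0 at hx
      rw [h1] at hx
      have hx : x = 0 := hx
      subst hx
      exact ⟨w, hxw.2.2, by simp only [zero_add]⟩

/-- The map `v ↦ Ψ (x₁, v)`, with values in the image of `Ω`. -/
theorem IsDiffeoOn.exists_slice_param {F X : LCSpace.{v}} {Ψ : F × X → M} {W : Set F}
    {Ω : Set X} {V : Set M} (h : IsDiffeoOn Ψ (W ×ˢ Ω) V) {x₁ : F} (hx₁ : x₁ ∈ W)
    (hΩ : IsOpen Ω) (hΩn : Ω.Nonempty) [IsSubmanifold ((fun v => Ψ (x₁, v)) '' Ω)] :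
    ∃ ι : X → (fun v => Ψ (x₁, v)) '' Ω, IsDiffeoOn ι Ω univ ∧
      ∀ v ∈ Ω, (ι v : M) = Ψ (x₁, v) := by
  classical
  obtain ⟨g, hg, hgs, hgm⟩ := h.exists_inv
  obtain ⟨v₀, hv₀⟩ := hΩn
  -- The value at `v₀` only makes the map total; nothing depends on it outside `Ω`.
  let ι : X → (fun v => Ψ (x₁, v)) '' Ω := fun v =>
    if hv : v ∈ Ω then ⟨Ψ (x₁, v), v, hv, rfl⟩ else ⟨Ψ (x₁, v₀), v₀, hv₀, rfl⟩
  have hι : ∀ v ∈ Ω, (ι v : M) = Ψ (x₁, v) := fun v hv => by simp only [ι, dif_pos hv]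
  have hS : ∀ s : (fun v => Ψ (x₁, v)) '' Ω, ∃ v ∈ Ω, Ψ (x₁, v) = s := fun s => s.2
  refine ⟨ι, IsDiffeoOn.of_invOn (M := X) (f := ι) (g := fun s => (g s).2) hΩ isOpen_univ ?_ ?_ (mapsTo_univ _ _)
    ?_ ⟨?_, ?_⟩, hι⟩
  · refine SmoothOn.codRestrict hΩ (SmoothOn.congr hΩ ?_ fun v hv => (hι v hv).symm)
    exact h.smoothOn.comp h.isOpen_source hΩ ((smoothOn_const x₁ _).prodMk hΩ (smoothOn_id _))
      fun v hv => ⟨hx₁, hv⟩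
  · refine SmoothOn.snd isOpen_univ (hgs.comp h.isOpen_target isOpen_univ
      (smoothOn_subtypeVal _ _) fun s _ => ?_)
    obtain ⟨v, hv, hs⟩ := hS s
    rw [← hs]
    exact h.bijOn.mapsTo ⟨hx₁, hv⟩
  · intro s _
    obtain ⟨v, hv, hs⟩ := hS s
    change (g s).2 ∈ Ω
    rw [← hs, hg.1 ⟨hx₁, hv⟩]
    exact hv
  · intro v hv
    simp only [hι v hv, hg.1 (show (x₁, v) ∈ W ×ˢ Ω from ⟨hx₁, hv⟩)]
  · intro s _
    obtain ⟨v, hv, hs⟩ := hS s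
    refine Subtype.ext ?_
    simp only [← hs, hg.1 (show (x₁, v) ∈ W ×ˢ Ω from ⟨hx₁, hv⟩), hι v hv]
end Tube

/-! ### Linearity of the directional derivative. -/

section Linear

variable {E : LCSpace.{u}} {F : LCSpace.{v}} {f : E → F} {U : Set E} {x : E}

theorem IsSmooth.dirDeriv_smul (h : IsSmooth f U) (hx : x ∈ U) (r : ℝ) (v : E) :
    LC.dirDeriv f x (r • v) = r • LC.dirDeriv f x v := by
  have h1 := (h 1).2.1 x hx v
  -- For `r ≠ 0` the substitution `t ↦ t * r` preserves the punctured neighbourhoods of `0`, which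
  -- fails for `r = 0`.
  rcases eq_or_ne r 0 with rfl | hr
  · have h2 : HasDirDeriv f x ((0 : ℝ) • v) 0 := by simp [HasDirDeriv]
    rw [h2.eq, zero_smul]
  · refine HasDirDeriv.eq ?_
    have h2 : Tendsto (fun t : ℝ => t * r) (𝓝[≠] 0) (𝓝[≠] 0) := by
      refine tendsto_nhdsWithin_iff.2 ⟨?_, ?_⟩
      · have : ContinuousAt (fun t : ℝ => t * r) 0 := by fun_prop
        refine Tendsto.mono_left ?_ nhdsWithin_le_nhds
        simpa [ContinuousAt] using this
      · filter_upwards [self_mem_nhdsWithin] with t ht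
        exact mul_ne_zero ht hr
    refine ((Tendsto.comp h1 h2).const_smul r).congr fun t => ?_
    simp only [Function.comp_apply, smul_smul, mul_inv]
    congr 1
    field_simp

/-- The quotient in direction `v + w` splits into one along `v` at `x` and one along `w` at the
moving point `x + t • v`. The second converges because slopes of a `C^1` map converge jointly in the
base point and the direction. -/
theorem IsSmooth.dirDeriv_add (hU : IsOpen U) (h : IsSmooth f U) (hx : x ∈ U) (v w : E) :
    LC.dirDeriv f x (v + w) = LC.dirDeriv f x v + LC.dirDeriv f x w := by
  refine HasDirDeriv.eq ?_
  have h1 := (h 1).2.1 x hx v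
  have h2 : Tendsto (fun t : ℝ => t⁻¹ • (f ((x + t • v) + t • w) - f (x + t • v))) (𝓝[≠] 0)
      (𝓝 (LC.dirDeriv f x w)) := by
    have h3 : Tendsto (fun t : ℝ => x + t • v) (𝓝[≠] 0) (𝓝 x) := by
      have : ContinuousAt (fun t : ℝ => x + t • v) 0 := by fun_prop
      refine Tendsto.mono_left ?_ nhdsWithin_le_nhds
      simpa [ContinuousAt] using this
    exact ((h 1).tendsto_slope hU hx w).comp
      ((h3.prodMk_nhds tendsto_const_nhds).prodMk tendsto_id)
  refine (h1.add h2).congr fun t => ?_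
  rw [← smul_add, smul_add t, add_assoc]
  congr 1
  abel

end Linear

/-! ### Tangent maps in arbitrary compatible charts. -/

section TangentMaps

variable {M : Type u} [TopologicalSpace M] [Manifold M] {N : Type v} [TopologicalSpace N]
  [Manifold N] {P : Type w} [TopologicalSpace P] [Manifold P]

/-- The representation of a map in charts. -/
noncomputable def localMap (f : M → N) (c : Chart M) (c' : Chart N) : c.space → c'.space :=
  fun x => c'.map (f (c.map.symm x))

/-- Chain rule in charts. -/
theorem dirDeriv_localMap_comp {f : M → N} {g : N → P} {W : Set M} {V : Set N} (hW : IsOpen W)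
    (hV : IsOpen V) (hf : SmoothOn f W) (hg : SmoothOn g V) {p : M} (hpW : p ∈ W) (hpV : f p ∈ V)
    {a : Chart M} (ha : a ∈ maximalAtlas M) (hpa : p ∈ a.map.source) {b : Chart N}
    (hb : b ∈ maximalAtlas N) (hpb : f p ∈ b.map.source) {c : Chart P} (hc : c ∈ maximalAtlas P)
    (hpc : g (f p) ∈ c.map.source) (v : a.space) :
    dirDeriv (localMap g b c) (b.map (f p)) (dirDeriv (localMap f a b) (a.map p) v) =
      dirDeriv (localMap (fun x => g (f x)) a c) (a.map p) v := by
  have h1 := hf.isSmooth hW ha hb 1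
  have h2 := hg.isSmooth hV hb hc 1
  have ho1 := isOpen_chartDomain hW hf.1 a b
  have ho2 := isOpen_chartDomain hV hg.1 b c
  have hx : a.map p ∈ a.map.target ∩ a.map.symm ⁻¹' (W ∩ f ⁻¹' b.map.source) := by
    refine ⟨a.map.map_source hpa, ?_⟩
    simpa only [mem_preimage, a.map.left_inv hpa] using ⟨hpW, hpb⟩
  have e : localMap f a b (a.map p) = b.map (f p) := by
    simp only [localMap, a.map.left_inv hpa]
  have hy : localMap f a b (a.map p) ∈
      b.map.target ∩ b.map.symm ⁻¹' (V ∩ g ⁻¹' c.map.source) := by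
    rw [e]
    refine ⟨b.map.map_source hpb, ?_⟩
    simpa only [mem_preimage, b.map.left_inv hpb] using ⟨hpV, hpc⟩
  have h3 := HasDirDeriv.comp ho2 h2 (h1.2.1 _ hx v) hy
  have h4 := HasDirDeriv.congr (g := localMap (fun x => g (f x)) a c) ho1 hx (by
    rintro z ⟨-, -, hz⟩
    have hz : f (a.map.symm z) ∈ b.map.source := hz
    simp only [localMap, b.map.left_inv hz]) h3
  rw [h4.eq, ← e]
  rfl

/-- Both sides are the derivative of `f` from the preferred chart at `p` to `c'`. The chain rule is
applied once with `f` followed by the identity of `N`, once with the identity of `M` followed by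
`f`. -/
theorem Chart.deriv_tangentMap {f : M → N} {W : Set M} (hW : IsOpen W) (hf : SmoothOn f W)
    {p : M} (hpW : p ∈ W) {c : Chart M} (hc : c ∈ maximalAtlas M) (hpc : p ∈ c.map.source)
    {c' : Chart N} (hc' : c' ∈ maximalAtlas N) (hpc' : f p ∈ c'.map.source) (v : TangentSpace p) :
    c'.deriv (f p) (tangentMap f p v) =
      dirDeriv (localMap f c c') (c.map p) (c.deriv p v) := by
  have hk := atlas_subset_maximalAtlas (chartAt_mem p)
  have hk' := atlas_subset_maximalAtlas (chartAt_mem (f p))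
  have h1 := dirDeriv_localMap_comp hW isOpen_univ hf (smoothOn_id univ) hpW trivial hk
    (mem_chartAt_source p) hk' (mem_chartAt_source (f p)) hc' hpc' v
  have h2 := dirDeriv_localMap_comp isOpen_univ hW (smoothOn_id univ) hf trivial hpW hk
    (mem_chartAt_source p) hc hpc hc' hpc' v
  exact h1.trans h2.symm

theorem Chart.deriv_chartAt (p : M) (v : TangentSpace p) : (chartAt p).deriv p v = v :=
  dirDeriv_change_self ((chartAt p).map.map_source (mem_chartAt_source p)) v

theorem TangentBundle.ext_chart {c : Chart M} (hc : c ∈ maximalAtlas M) {X Y : TangentBundle M}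
    (hX : X.proj ∈ c.map.source) (h : X.proj = Y.proj)
    (h' : c.deriv X.proj X.vec = c.deriv Y.proj Y.vec) : X = Y :=
  (c.tangentEquiv hc).injOn hX (show Y.proj ∈ c.map.source from h ▸ hX)
    (Prod.ext (congrArg c.map h) h')

/-- In the bundle chart over the preferred chart at `p`, the inclusion of the fibre is `v ↦ (chartAt
p p, v)`, which is continuous. -/
theorem isOpen_tangentSpace_preimage {U : Set (TangentBundle M)} (hU : IsOpen U) (p : M) :
    IsOpen {v : TangentSpace p | TangentBundle.mk p v ∈ U} := by
  have h := hU (chartAt p) (chartAt_mem p)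
  have h1 : Continuous fun v : TangentSpace p => (((chartAt p).map p, v) :
    (chartAt p).space × (chartAt p).space) := Continuous.prodMk continuous_const continuous_id
  convert h.preimage h1 using 1
  ext v
  have hp := mem_chartAt_source p
  have e := ((chartAt p).tangentEquiv (atlas_subset_maximalAtlas (chartAt_mem p))).left_inv
    (x := ⟨p, v⟩) hp
  have e' : (chartAt p).tangentEquiv (atlas_subset_maximalAtlas (chartAt_mem p)) ⟨p, v⟩ =
    (((chartAt p).map p, v) : (chartAt p).space × (chartAt p).space) :=
    Prod.ext rfl (Chart.deriv_chartAt p v)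
  rw [e'] at e
  constructor
  · intro hv
    refine ⟨(chartAt p).map.map_source hp, ?_⟩
    rw [e]
    exact hv
  · rintro ⟨-, hv⟩
    rwa [e] at hv

end TangentMaps

/-! ### The derivative of a smooth action along the manifold. -/

section Actions

variable {G : Type u} {M : Type v} [Group G] [TopologicalSpace G] [Manifold G]
  [TopologicalSpace M] [Manifold M] [MulAction G M]

theorem IsSmoothAction.smoothOn_smul (h : IsSmoothAction G M) (g : G) (W : Set M) :
    SmoothOn (fun x : M => g • x) W :=
  SmoothOn.mono (SmoothOn.comp isOpen_univ h isOpen_univ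
    ((smoothOn_const g univ).prodMk isOpen_univ (smoothOn_id univ)) fun _ _ => trivial)
    (subset_univ W)

/-- The derivative of the action in the direction of `M`, in charts of `M`. -/
noncomputable def actDeriv (c c' : Chart M) (q : G × (c.space × c.space)) : c'.space :=
  dirDeriv (localMap (fun x : M => q.1 • x) c c') q.2.1 q.2.2

theorem IsSmoothAction.isOpen_actDeriv_domain (h : IsSmoothAction G M) (c c' : Chart M) :
    IsOpen {q : G × (c.space × c.space) | q.2.1 ∈ c.map.target ∧
      q.1 • c.map.symm q.2.1 ∈ c'.map.source} := by
  have h1 : ContinuousOn (fun q : G × (c.space × c.space) => q.1 • c.map.symm q.2.1)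
      {q | q.2.1 ∈ c.map.target} := by
    refine h.1.comp (continuous_fst.continuousOn.prodMk (c.map.continuousOn_symm.comp
      (by fun_prop) fun q hq => hq)) fun _ _ => trivial
  exact h1.isOpen_inter_preimage (c.map.open_target.preimage (by fun_prop)) c'.map.open_source

/-- The partial derivative is the total derivative of `G × M → M` in a direction with vanishing
group component, hence smooth jointly in the group element, the point and the vector. -/
theorem IsSmoothAction.smoothOn_actDeriv (h : IsSmoothAction G M) {c c' : Chart M}
    (hc : c ∈ maximalAtlas M) (hc' : c' ∈ maximalAtlas M) :
    SmoothOn (actDeriv (G := G) c c') {q | q.2.1 ∈ c.map.target ∧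
      q.1 • c.map.symm q.2.1 ∈ c'.map.source} := by
  refine SmoothOn.of_charts fun q hq => ?_
  have hγ := atlas_subset_maximalAtlas (chartAt_mem q.1)
  set γ := chartAt q.1 with hγ'
  have ho := h.isOpen_actDeriv_domain c c'
  refine ⟨γ.prod (c.space.chart.prod c.space.chart), Chart.prod_mem_maximalAtlas hγ
    (Chart.prod_mem_maximalAtlas c.space.chart_mem c.space.chart_mem), c'.space.chart,
    c'.space.chart_mem, _, ho.inter (γ.map.open_source.preimage continuous_fst),
    ⟨hq, mem_chartAt_source q.1⟩, fun y hy => ⟨hy.2, trivial, trivial⟩, fun _ _ => trivial, ?_⟩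
  have h1 := h.isSmooth isOpen_univ (Chart.prod_mem_maximalAtlas hγ hc) hc'
  have h2 := h1.dirDeriv
  have ho1 := isOpen_chartDomain isOpen_univ h.1 (γ.prod c) c'
  set O := (γ.prod c).map.target ∩
    (γ.prod c).map.symm ⁻¹' (univ ∩ (fun z : G × M => z.1 • z.2) ⁻¹' c'.map.source)
  -- `L` sends `(z, x, v)` to the base point `(z, x)` and the direction `(0, v)`. The group
  -- coordinate then stays fixed along the difference quotient.
  let L : γ.space × (c.space × c.space) →L[ℝ] (γ.space × c.space) × (γ.space × c.space) :=
    ((ContinuousLinearMap.fst ℝ _ _).prod ((ContinuousLinearMap.fst ℝ _ _).comp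
      (ContinuousLinearMap.snd ℝ _ _))).prod ((0 : _ →L[ℝ] γ.space).prod
      ((ContinuousLinearMap.snd ℝ _ _).comp (ContinuousLinearMap.snd ℝ _ _)))
  have h3 : ∀ n, IsCn n _ (L ⁻¹' (O ×ˢ univ)) := fun n => (h2 n).comp_clm L
  have ho3 : IsOpen (L ⁻¹' (O ×ˢ univ)) := (ho1.prod isOpen_univ).preimage L.continuous
  intro n
  refine ((h3 n).congr ho3 (g := fun y : γ.space × (c.space × c.space) =>
    actDeriv c c' (γ.map.symm y.1, y.2)) ?_).mono ?_
  · intro y hy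
    refine congrArg (limUnder (𝓝[≠] (0 : ℝ))) (funext fun t => ?_)
    change t⁻¹ • (c'.map (γ.map.symm (y.1 + t • 0) • c.map.symm (y.2.1 + t • y.2.2)) - _) =
      t⁻¹ • (c'.map (γ.map.symm y.1 • c.map.symm (y.2.1 + t • y.2.2)) - _)
    rw [smul_zero, add_zero]
    rfl
  · rintro ⟨z, x, v⟩ ⟨⟨hz, -, -⟩, ⟨hx, hx'⟩, -⟩
    exact ⟨⟨⟨hz, hx⟩, trivial, hx'⟩, trivial⟩

/-- The derivative of the action in charts represents the tangent map. -/
theorem IsSmoothAction.deriv_tangentMap (h : IsSmoothAction G M) {c c' : Chart M}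
    (hc : c ∈ maximalAtlas M) (hc' : c' ∈ maximalAtlas M) (g : G) {p : M}
    (hp : p ∈ c.map.source) (hp' : g • p ∈ c'.map.source) (v : TangentSpace p) :
    c'.deriv (g • p) (tangentMap (fun x : M => g • x) p v) =
      actDeriv c c' (g, (c.map p, c.deriv p v)) :=
  Chart.deriv_tangentMap isOpen_univ (h.smoothOn_smul g univ) trivial hc hp hc' hp' v

end Actions

/-! ### The inverse function theorem in finite dimensions. -/

section FiniteDimensional

theorem dirDeriv_eq_of_eqOn_clm {E : LCSpace.{u}} {F : LCSpace.{v}} {g : E → F} (L : E →L[ℝ] F)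
    {U : Set E} (hU : IsOpen U) {x : E} (hx : x ∈ U) (h : EqOn L g U) (v : E) :
    dirDeriv g x v = L v := by
  refine (HasDirDeriv.congr hU hx h ?_).eq
  refine Tendsto.congr' ?_ tendsto_const_nhds
  filter_upwards [self_mem_nhdsWithin] with t ht
  have ht : t ≠ 0 := ht
  simp [smul_smul, ht]

/-- In finite dimensions, a `C^1` map is strictly Fréchet differentiable. -/
theorem IsCn.hasStrictFDerivAt {E F : Type*} [NormedAddCommGroup E] [NormedSpace ℝ E]
    [FiniteDimensional ℝ E] [NormedAddCommGroup F] [NormedSpace ℝ F] {f : E → F} {U : Set E}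
    (hU : IsOpen U) (h : IsCn 1 f U) {x : E} (hx : x ∈ U) {L : E →L[ℝ] F}
    (hL : ∀ v, dirDeriv f x v = L v) : HasStrictFDerivAt f L x := by
  refine HasStrictFDerivAt.of_isLittleO (Asymptotics.IsLittleO.of_bound fun ε hε => ?_)
  have : ProperSpace E := FiniteDimensional.proper ℝ E
  -- Joint convergence of slopes near each direction becomes uniform over all unit vectors, since
  -- the unit sphere is compact.
  have key : ∀ᶠ q in 𝓝 (x, (0 : ℝ)), ∀ v ∈ Metric.sphere (0 : E) 1, q.2 ≠ 0 →
      ‖q.2⁻¹ • (f (q.1 + q.2 • v) - f q.1) - L v‖ ≤ ε := by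
    refine (isCompact_sphere (0 : E) 1).eventually_forall_of_forall_eventually fun v _ => ?_
    have h1 := h.tendsto_slope hU hx v
    rw [hL] at h1
    have h2 : Tendsto (fun p : (E × E) × ℝ => L p.1.2) (𝓝 (x, v) ×ˢ 𝓝[≠] 0) (𝓝 (L v)) :=
      (L.continuous.tendsto v).comp (((continuous_snd (X := E) (Y := E)).tendsto (x, v)).comp
        tendsto_fst)
    have h3 := (h1.sub h2).norm
    rw [sub_self, norm_zero] at h3
    have h4 := h3.eventually (ge_mem_nhds hε)
    obtain ⟨pa, hpa, pb, hpb, hab⟩ := eventually_prod_iff.1 h4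
    rw [eventually_nhdsWithin_iff] at hpb
    have h5 : Tendsto (fun z : (E × ℝ) × E => (z.1.1, z.2)) (𝓝 ((x, 0), v)) (𝓝 (x, v)) :=
      Continuous.tendsto (by fun_prop) _
    have h6 : Tendsto (fun z : (E × ℝ) × E => z.1.2) (𝓝 ((x, 0), v)) (𝓝 0) :=
      Continuous.tendsto (by fun_prop) _
    filter_upwards [h5.eventually hpa, h6.eventually hpb] with z hz1 hz2 hz3
    exact hab hz1 (hz2 hz3)
  have hc : ContinuousAt (fun p : E × E => (p.2, ‖p.1 - p.2‖)) (x, x) := by fun_prop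
  have hc' : Tendsto (fun p : E × E => (p.2, ‖p.1 - p.2‖)) (𝓝 (x, x)) (𝓝 (x, 0)) := by
    simpa [ContinuousAt] using hc
  filter_upwards [hc'.eventually key] with p hp
  rcases eq_or_ne p.1 p.2 with h0 | h0
  · simp [h0]
  · have ht : ‖p.1 - p.2‖ ≠ 0 := norm_ne_zero_iff.2 (sub_ne_zero.2 h0)
    -- The increment `p.1 - p.2` is written as its length times a unit vector, with base point
    -- `p.2`.
    have h1 := hp (‖p.1 - p.2‖⁻¹ • (p.1 - p.2)) (by simp [norm_smul, ht]) ht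
    simp only [smul_smul, mul_inv_cancel₀ ht, one_smul, add_sub_cancel, map_smul, ← smul_sub,
      norm_smul, norm_inv, norm_norm] at h1
    rwa [inv_mul_le_iff₀ (by positivity), mul_comm] at h1

/-- Inverse function theorem: in finite dimensions, a smooth map with injective derivative is
locally open. -/
theorem IsSmooth.image_mem_nhds {F : LCSpace.{u}} [FiniteDimensional ℝ F] {f : F → F} {U : Set F}
    (hU : IsOpen U) (h : IsSmooth f U) {x : F} (hx : x ∈ U)
    (hinj : Function.Injective (LC.dirDeriv f x)) {s : Set F} (hs : s ∈ 𝓝 x) :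
    f '' s ∈ 𝓝 (f x) := by
  -- `F` carries only a vector space topology, so the map is transported to a coordinate space with
  -- a norm. The injective endomorphism `dirDeriv f x` is invertible by dimension.
  let e : F ≃L[ℝ] (Fin (Module.finrank ℝ F) → ℝ) :=
    (Module.finBasis ℝ F).equivFun.toContinuousLinearEquiv
  let L₀ : F →ₗ[ℝ] F :=
    { toFun := LC.dirDeriv f x
      map_add' := h.dirDeriv_add hU hx
      map_smul' := h.dirDeriv_smul hx }
  let L₁ : F ≃L[ℝ] F := (LinearEquiv.ofInjectiveEndo L₀ hinj).toContinuousLinearEquiv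
  let L : (Fin (Module.finrank ℝ F) → ℝ) ≃L[ℝ] (Fin (Module.finrank ℝ F) → ℝ) :=
    (e.symm.trans L₁).trans e
  have h1 : IsCn 1 (fun y => f (e.symm y)) (e.symm ⁻¹' U) :=
    (h 1).comp_clm (e.symm : (Fin (Module.finrank ℝ F) → ℝ) →L[ℝ] F)
  have hUo : IsOpen (e.symm ⁻¹' U) := hU.preimage e.symm.continuous
  have h2 : IsCn 1 (fun y => e (f (e.symm y))) (e.symm ⁻¹' U) :=
    IsCn.comp (g := e) isOpen_univ
      (isCn_clm 1 (e : F →L[ℝ] (Fin (Module.finrank ℝ F) → ℝ)) univ) hUo h1 fun _ _ => trivial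
  have hx' : e x ∈ e.symm ⁻¹' U := by simpa using hx
  have h3 : HasStrictFDerivAt (fun y => e (f (e.symm y))) (L : _ →L[ℝ] _) (e x) := by
    refine h2.hasStrictFDerivAt hUo hx' fun v => HasDirDeriv.eq ?_
    have h4 := (h 1).2.1 x hx (e.symm v)
    refine ((e.continuous.tendsto _).comp h4).congr fun t => ?_
    simp
  have h4 := h3.map_nhds_eq_of_equiv
  have h5 : e '' (f '' s) ∈ 𝓝 (e (f x)) := by
    have h6 : e.symm ⁻¹' s ∈ 𝓝 (e x) :=
      e.symm.continuous.continuousAt.preimage_mem_nhds (by simpa using hs)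
    have h7 := image_mem_map (m := fun y => e (f (e.symm y))) h6
    rw [h4] at h7
    simp only [ContinuousLinearEquiv.symm_apply_apply] at h7
    refine mem_of_superset h7 ?_
    rintro _ ⟨y, hy, rfl⟩
    exact ⟨_, ⟨_, hy, rfl⟩, rfl⟩
  have h6 := e.continuous.continuousAt.preimage_mem_nhds h5
  rwa [preimage_image_eq _ e.injective] at h6

end FiniteDimensional

/-! ### Compact Lie subgroups and their conjugates. -/

section CompactGroups

theorem IsLieGroup.isTopologicalGroup (G : Type u) [Group G] [TopologicalSpace G] [Manifold G]
    [IsLieGroup G] : IsTopologicalGroup G where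
  continuous_mul := continuousOn_univ.1 IsLieGroup.smooth_mul.1
  continuous_inv := continuousOn_univ.1 IsLieGroup.smooth_inv.1

variable {G : Type u} [Group G] [TopologicalSpace G] [Manifold G] [IsLieGroup G]

theorem SmoothOn.mul {M : Type v} [TopologicalSpace M] [Manifold M] {f g : M → G} {W : Set M}
    (hW : IsOpen W) (hf : SmoothOn f W) (hg : SmoothOn g W) : SmoothOn (fun x => f x * g x) W :=
  IsLieGroup.smooth_mul.comp isOpen_univ hW (hf.prodMk hW hg) fun _ _ => trivial

theorem SmoothOn.inv {M : Type v} [TopologicalSpace M] [Manifold M] {f : M → G} {W : Set M}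
    (hW : IsOpen W) (hf : SmoothOn f W) : SmoothOn (fun x => (f x)⁻¹) W :=
  IsLieGroup.smooth_inv.comp isOpen_univ hW hf fun _ _ => trivial

/-- The model space of a compact Lie subgroup has finite dimension. -/
theorem IsSliceChart.finiteDimensional {H : Subgroup G} (hH : IsCompact (H : Set G))
    {c : Chart G} {F : Submodule ℝ c.space} (h : IsSliceChart (H : Set G) c F)
    (h1 : 1 ∈ c.map.source) : FiniteDimensional ℝ F := by
  have := IsLieGroup.isTopologicalGroup G
  have : CompactSpace H := isCompact_iff_compactSpace.1 hH
  -- A compact neighbourhood of `1` inside the chart domain is carried to a compact neighbourhood of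
  -- a point of `F`. So `F` is locally compact, and hence finite-dimensional.
  obtain ⟨K, hK, h1K, hKs⟩ := exists_compact_subset (X := H) (x := 1)
    (h.homeo (1 : H)).open_source h1
  have hK' : IsCompact (h.homeo (1 : H) '' K) :=
    IsCompact.image_of_continuousOn hK ((h.homeo (1 : H)).continuousOn.mono hKs)
  have hn : h.homeo (1 : H) '' K ∈ 𝓝 (h.homeo (1 : H) (1 : H)) :=
    (h.homeo (1 : H)).image_mem_nhds h1 (mem_interior_iff_mem_nhds.1 h1K)
  have : LocallyCompactSpace F := hK'.locallyCompactSpace_of_mem_nhds_of_addGroup hn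
  exact FiniteDimensional.of_locallyCompactSpace ℝ

/-- A smooth injective endomorphism of a compact Lie subgroup which is the restriction of an inner
automorphism of the ambient group is open at the identity. -/
theorem IsSubmanifold.conj_image_mem_nhds {H : Subgroup G} [IsSubmanifold (H : Set G)]
    (hH : IsCompact (H : Set G)) (a : G) (φ : H → H) (hφ : ∀ x, (φ x : G) = a * x * a⁻¹)
    {s : Set H} (hs : s ∈ 𝓝 1) : φ '' s ∈ 𝓝 1 := by
  obtain ⟨c, h1, F, h⟩ := IsSubmanifold.exists_sliceChart (S := (H : Set G)) 1 H.one_mem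
  have : FiniteDimensional ℝ (c.space.sub F) := h.finiteDimensional hH h1
  let S : Set G := H
  let o : S := (1 : H)
  let d : Chart S := h.restrict o
  have hd : d ∈ maximalAtlas S := atlas_subset_maximalAtlas ⟨c, F, h, o, rfl⟩
  have ho : o ∈ d.map.source := h1
  have hφo : φ o = o := Subtype.ext ((hφ 1).trans (by
    change a * 1 * a⁻¹ = 1
    group))
  have hφs : SmoothOn (M := S) (N := S) φ univ := by
    refine SmoothOn.codRestrict isOpen_univ (SmoothOn.congr isOpen_univ ?_ fun x _ => (hφ x).symm)
    exact ((smoothOn_const a univ).mul isOpen_univ (smoothOn_subtypeVal S univ)).mul isOpen_univ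
      (smoothOn_const a⁻¹ univ)
  have hμs : SmoothOn (fun x : S => a⁻¹ * (x : G) * a) univ :=
    ((smoothOn_const a⁻¹ univ).mul isOpen_univ (smoothOn_subtypeVal S univ)).mul isOpen_univ
      (smoothOn_const a univ)
  have hf := hφs.isSmooth isOpen_univ hd hd
  have hfo := isOpen_chartDomain isOpen_univ hφs.1 d d
  have hy : d.map o ∈ d.map.target ∩ d.map.symm ⁻¹' (univ ∩ (φ : S → S) ⁻¹' d.map.source) := by
    refine ⟨d.map.map_source ho, trivial, ?_⟩
    simpa only [mem_preimage, d.map.left_inv ho, hφo] using ho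
  -- Conjugating back by `a⁻¹` turns `φ` into the inclusion of `H`, whose derivative in charts is
  -- the inclusion of `F`. The conjugation back is taken with values in `G`, as it need not map `H`
  -- into itself.
  have hinj : Function.Injective (LC.dirDeriv (localMap (M := S) (N := S) φ d d) (d.map o)) := by
    have e : (fun x : S => a⁻¹ * ((φ x : S) : G) * a) = fun x : S => (x : G) := by
      funext x
      rw [hφ x]
      group
    have h3 : ∀ v : c.space.sub F, LC.dirDeriv (localMap (fun x : S => (x : G)) d c) (d.map o) v =
        F.subtypeL v := by
      intro v
      refine dirDeriv_eq_of_eqOn_clm (E := c.space.sub F) F.subtypeL d.map.open_target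
        (d.map.map_source ho) (fun x hx => ?_) v
      have hx' : x.val ∈ c.map.target := hx
      exact ((congrArg c.map (h.homeo_symm_apply o hx')).trans (c.map.right_inv hx')).symm
    intro v w hvw
    have h2 := fun u => dirDeriv_localMap_comp (M := S) (N := S) (p := o) (c := c) isOpen_univ
      isOpen_univ hφs hμs trivial trivial hd ho hd (by rw [hφo]; exact ho) h.mem_maximalAtlas
      (by rw [hφo]; simpa [o] using h1) u
    have h4 := (h2 v).symm.trans ((congrArg _ hvw).trans (h2 w))
    rw [e] at h4
    exact Subtype.ext ((h3 v).symm.trans (h4.trans (h3 w)))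
  have hs' : d.map.target ∩ d.map.symm ⁻¹' (univ ∩ (φ : S → S) ⁻¹' d.map.source) ∩
      d.map.symm ⁻¹' s ∈ 𝓝 (d.map o) := by
    refine inter_mem (hfo.mem_nhds hy) ?_
    refine (d.map.continuousAt_symm (d.map.map_source ho)).preimage_mem_nhds ?_
    rw [d.map.left_inv ho]
    exact hs
  have h5 := IsSmooth.image_mem_nhds (F := c.space.sub F) hfo hf hy hinj hs'
  have h6 : d.map (φ (d.map.symm (d.map o))) = d.map o := by
    rw [d.map.left_inv ho, hφo]
  rw [h6] at h5
  have h7 := (d.map.continuousAt ho).preimage_mem_nhds h5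
  refine mem_of_superset (inter_mem h7 (d.map.open_source.mem_nhds ho)) ?_
  rintro x ⟨⟨y, ⟨⟨hy1, -, hy2⟩, hy3⟩, hyx⟩, hx⟩
  exact ⟨d.map.symm y, hy3, d.map.injOn hy2 hx hyx⟩

/-- By local convexity of the model space, a chart contains a convex neighbourhood of the image of
`1`, and its preimage is connected. This makes the identity component open. -/
theorem IsSubmanifold.connectedComponent_mem_nhds {H : Subgroup G} [IsSubmanifold (H : Set G)] :
    connectedComponent (1 : H) ∈ 𝓝 1 := by
  obtain ⟨c, h1, F, h⟩ := IsSubmanifold.exists_sliceChart (S := (H : Set G)) 1 H.one_mem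
  let e := h.homeo (1 : H)
  have h1 : (1 : H) ∈ e.source := h1
  obtain ⟨B, hB, hBc, hBt⟩ := (locallyConvexSpace_iff_exists_convex_subset ℝ F).1
    (c.space.sub F).locallyConvexSpace (e (1 : H)) e.target
    (e.open_target.mem_nhds (e.map_source h1))
  have h2 : IsPreconnected (e.symm '' B) :=
    hBc.isPreconnected.image _ (e.continuousOn_symm.mono hBt)
  have h3 : (1 : H) ∈ e.symm '' B := ⟨_, mem_of_mem_nhds hB, e.left_inv h1⟩
  have h4 : e.symm '' B ∈ 𝓝 (e.symm (e (1 : H))) := e.symm.image_mem_nhds (e.map_source h1) hB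
  rw [e.left_inv h1] at h4
  exact mem_of_superset h4 (h2.subset_connectedComponent h3)

/-- A compact Lie subgroup is not conjugate to a proper subgroup of itself. -/
theorem IsSubmanifold.map_conj_eq {H : Subgroup G} [IsSubmanifold (H : Set G)]
    (hH : IsCompact (H : Set G)) (a : G) (ha : H.map (MulAut.conj a).toMonoidHom ≤ H) :
    H.map (MulAut.conj a).toMonoidHom = H := by
  have := IsLieGroup.isTopologicalGroup G
  have : CompactSpace H := isCompact_iff_compactSpace.1 hH
  let φ : H →* H := ((MulAut.conj a).toMonoidHom.comp H.subtype).codRestrict H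
    fun x => ha ⟨x, x.2, rfl⟩
  have hφ : ∀ x, (φ x : G) = a * x * a⁻¹ := fun _ => rfl
  have hφc : Continuous φ := Continuous.subtype_mk
    ((continuous_const.mul continuous_subtype_val).mul continuous_const) _
  have hφi : φ.ker = ⊥ := by
    refine (MonoidHom.ker_eq_bot_iff φ).2 fun x y hxy => ?_
    have h1 : a * x * a⁻¹ = a * y * a⁻¹ := congrArg Subtype.val hxy
    exact Subtype.ext (mul_left_cancel (mul_right_cancel h1))
  let C := Subgroup.connectedComponentOfOne H
  have hCn : (C : Set H) ∈ 𝓝 1 := IsSubmanifold.connectedComponent_mem_nhds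
  have hCo : IsOpen (C : Set H) := C.isOpen_of_mem_nhds hCn
  have hφCo : IsOpen (C.map φ : Set H) :=
    (C.map φ).isOpen_of_mem_nhds (g := 1) (IsSubmanifold.conj_image_mem_nhds hH a φ hφ hCn)
  have hle : C.map φ ≤ C := by
    have h1 := hφc.image_connectedComponent_subset 1
    rw [map_one] at h1
    exact h1
  -- An open subgroup is also closed, so `φ(C)` is a clopen set containing `1` and swallows the
  -- identity component.
  have hge : C ≤ C.map φ := IsClopen.connectedComponent_subset
    ⟨(C.map φ).isClosed_of_isOpen hφCo, hφCo⟩ (C.map φ).one_mem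
  -- Since `φ` is injective with `φ(C) = C`, this reads `[H : C] = [H : C] · [H : φ(H)]`. The index
  -- of the open subgroup `C` is finite by compactness and can be cancelled.
  have hi := C.index_map φ
  have : Finite (H ⧸ C) := C.quotient_finite_of_isOpen hCo
  rw [le_antisymm hle hge, hφi, sup_bot_eq] at hi
  have h1 : φ.range.index = 1 := by
    have h0 : C.index ≠ 0 := Subgroup.index_ne_zero_of_finite
    exact (mul_eq_left₀ h0).1 hi.symm
  refine le_antisymm ha fun x hx => ?_
  obtain ⟨y, hy⟩ := MonoidHom.range_eq_top.1 (Subgroup.index_eq_one.1 h1) ⟨x, hx⟩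
  exact ⟨y, y.2, congrArg Subtype.val hy⟩

end CompactGroups

/-! ### From a tube to a linear slice. -/

section Slice

open MulAction

variable {G : Type u} {M : Type v} [Group G] [TopologicalSpace G] [Manifold G] [IsLieGroup G]
  [TopologicalSpace M] [Manifold M] [MulAction G M]

/-- The stabilizers of a proper action are compact. -/
theorem IsProperAction.isCompact_stabilizer (h : IsProperAction G M) (m : M) :
    IsCompact (stabilizer G m : Set G) := by
  -- The preimage of the point `(m, m)` is `G_m × {m}`.
  have h1 := (h {(m, m)} isCompact_singleton).image continuous_fst
  convert h1 using 1
  ext g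
  constructor
  · intro hg
    exact ⟨(g, m), Prod.ext hg rfl, rfl⟩
  · rintro ⟨⟨g', p⟩, hp, rfl⟩
    have hp' : (g' • p, p) = (m, m) := hp
    obtain ⟨h1, rfl⟩ := Prod.mk.injEq _ _ _ _ ▸ hp'
    exact h1

variable {m : M} [IsSubmanifold (stabilizer G m : Set G)] [Manifold (G ⧸ stabilizer G m)]

/-- A tube `Ψ` around the orbit of `m`, which is compatible with a local section of the group over
its homogeneous space and with a linear representation of the stabilizer, defines a linear
slice. -/
theorem isLinearSlice_of_tube (hcompact : IsCompact (stabilizer G m : Set G))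
    (hprincipal : IsPrincipalBundle (stabilizer G m)) {F X : LCSpace.{v}} {Ψ : F × X → M}
    {W : Set F} {Ω : Set X} {V : Set M} (hΨ : IsDiffeoOn Ψ (W ×ˢ Ω) V) (hΩ : IsOpen Ω)
    (h0 : (0 : X) ∈ Ω) {x₁ : F} (hx₁ : x₁ ∈ W) (hΨ0 : Ψ (x₁, 0) = m)
    (τ : Representation ℝ (stabilizer G m) X)
    (hτ : Continuous fun z : stabilizer G m × X => τ z.1 z.2)
    (hτΩ : ∀ h, ∀ v ∈ Ω, τ h v ∈ Ω)
    (hτΨ : ∀ h, ∀ v ∈ Ω, Ψ (x₁, τ h v) = (h : G) • Ψ (x₁, v))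
    {U : Set (G ⧸ stabilizer G m)} {χ : G ⧸ stabilizer G m → G} {ξ : G ⧸ stabilizer G m → F}
    (hU : ((1 : G) : G ⧸ stabilizer G m) ∈ U) (hχ : IsLocalSection χ U)
    (hξ : IsDiffeoOn ξ U W) (hξ1 : ξ ((1 : G) : G ⧸ stabilizer G m) = x₁)
    (hχΨ : ∀ q ∈ U, ∀ v ∈ Ω, Ψ (ξ q, v) = χ q • Ψ (x₁, v))
    (hnear : ∀ g : G, ∀ v ∈ Ω, ∀ w ∈ Ω, g • Ψ (x₁, v) = Ψ (x₁, w) →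
      (g : G ⧸ stabilizer G m) ∈ U) :
    IsLinearSlice G m ((fun v => Ψ (x₁, v)) '' Ω) := by
  have hS := hΨ.isSubmanifold_image hx₁
  obtain ⟨ι, hι, hιΨ⟩ := hΨ.exists_slice_param hx₁ hΩ ⟨0, h0⟩
  obtain ⟨k, hk, hks, hkm⟩ := hι.exists_inv
  have hkΩ : ∀ s, k s ∈ Ω := fun s => hkm (mem_univ s)
  have hιk : ∀ s, ι (k s) = s := fun s => hk.2 (mem_univ s)
  have hΨk : ∀ s, Ψ (x₁, k s) = s := fun s => by rw [← hιΨ _ (hkΩ s), hιk]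
  have hinj : ∀ v ∈ Ω, ∀ w ∈ Ω, Ψ (x₁, v) = Ψ (x₁, w) → v = w := fun v hv w hw h =>
    congrArg Prod.snd (hΨ.bijOn.injOn (show (x₁, v) ∈ W ×ˢ Ω from ⟨hx₁, hv⟩)
      (show (x₁, w) ∈ W ×ˢ Ω from ⟨hx₁, hw⟩) h)
  have hstab : ∀ g : G, ∀ v ∈ Ω, ∀ w ∈ Ω, g • Ψ (x₁, v) = Ψ (x₁, w) → g ∈ stabilizer G m := by
    intro g v hv w hw hg
    have hq := hnear g v hv w hw hg
    -- With `h = χ([g])⁻¹ g` the equation becomes `Ψ (ξ [g], τ h v) = Ψ (x₁, w)`. Injectivity of `Ψ`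
    -- and then of `ξ` gives `[g] = [1]`.
    have hh : (χ g)⁻¹ * g ∈ stabilizer G m := QuotientGroup.eq.1 (hχ.mk_eq _ hq)
    have h1 := hτΨ ⟨_, hh⟩ v hv
    have h2 := hχΨ _ hq _ (hτΩ ⟨_, hh⟩ v hv)
    rw [h1, smul_smul] at h2
    simp only [mul_inv_cancel_left] at h2
    rw [hg] at h2
    have h3 := hΨ.bijOn.injOn (show (ξ g, τ ⟨_, hh⟩ v) ∈ W ×ˢ Ω from
      ⟨hξ.bijOn.mapsTo hq, hτΩ _ v hv⟩) (show (x₁, w) ∈ W ×ˢ Ω from ⟨hx₁, hw⟩) h2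
    have h4 := hξ.bijOn.injOn hq hU ((congrArg Prod.fst h3).trans hξ1.symm)
    simpa using QuotientGroup.eq.1 h4.symm
  -- Since `G_s ≤ G_m`, conjugacy to the compact group `G_m` forces `G_s = G_m`, so `s` is fixed by
  -- `G_m`, that is, its coordinate `k s` is fixed by `τ`. Conversely, for a fixed coordinate `a =
  -- 1` works.
  have hfix : ∀ s : (fun v => Ψ (x₁, v)) '' Ω, (∃ a : G,
      stabilizer G (s : M) = (stabilizer G m).map (MulAut.conj a).toMonoidHom) ↔
      k s ∈ τ.invariants := by
    intro s
    have hle : stabilizer G (s : M) ≤ stabilizer G m := fun g hg => by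
      refine hstab g (k s) (hkΩ s) (k s) (hkΩ s) ?_
      rw [hΨk]
      exact hg
    have h1 : ∀ h : stabilizer G m, (h : G) • (s : M) = s ↔ τ h (k s) = k s := by
      intro h
      rw [← hΨk s, ← hτΨ h _ (hkΩ s), hΨk s]
      nth_rewrite 1 [← hΨk s]
      exact ⟨fun e => hinj _ (hτΩ h _ (hkΩ s)) _ (hkΩ s) e, fun e => by rw [e]⟩
    rw [Representation.mem_invariants]
    constructor
    · rintro ⟨a, ha⟩ h
      have h2 := IsSubmanifold.map_conj_eq hcompact a (ha ▸ hle)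
      refine (h1 h).1 ?_
      have h3 : (h : G) ∈ stabilizer G (s : M) := by
        rw [ha, h2]
        exact h.2
      exact h3
    · intro h
      refine ⟨1, ?_⟩
      rw [map_one]
      refine le_antisymm (fun g hg => ⟨g, hle hg, rfl⟩) ?_
      rintro _ ⟨g, hg, rfl⟩
      exact (h1 ⟨g, hg⟩).2 (h ⟨g, hg⟩)
  have hclosed : IsClosed (τ.invariants : Set X) := by
    have e : (τ.invariants : Set X) = ⋂ h, {v | τ h v = v} := by
      ext v
      simp [Representation.mem_invariants]
    rw [e]
    exact isClosed_iInter fun h => isClosed_eq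
      (hτ.comp (continuous_const.prodMk continuous_id)) continuous_id
  have hset : {s : (fun v => Ψ (x₁, v)) '' Ω | ∃ a : G,
      stabilizer G (s : M) = (stabilizer G m).map (MulAut.conj a).toMonoidHom} =
      k ⁻¹' (τ.invariants : Set X) := by
    ext s
    exact hfix s
  have hkc : Continuous k := continuousOn_univ.1 hks.1
  refine
    { isSubmanifold := hS
      mem := ⟨0, h0, hΨ0⟩
      smul_mem := ?_
      mem_stabilizer := ?_
      locally_product := ?_
      isClosed_partial := ?_
      isSubmanifold_partial := ?_
      linear := ?_ }
  · rintro g hg _ ⟨v, hv, rfl⟩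
    exact ⟨_, hτΩ ⟨g, hg⟩ v hv, hτΨ ⟨g, hg⟩ v hv⟩
  · rintro g _ ⟨v, hv, rfl⟩ ⟨w, hw, h⟩
    exact hstab g v hv w hw h.symm
  · refine ⟨inferInstance, inferInstance, hprincipal, U, χ, hU, hχ, V,
      hΨ0 ▸ hΨ.bijOn.mapsTo (show (x₁, (0 : X)) ∈ W ×ˢ Ω from ⟨hx₁, h0⟩), ?_⟩
    -- In the coordinates `ξ` on the base and `k` on the slice, the product map is `Ψ` itself.
    refine (hΨ.comp (hξ.prodMap (hι.symm_of_invOn hk))).congr ?_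
    rintro ⟨q, s⟩ ⟨hq, -⟩
    exact (hχΨ q hq _ (hkΩ s)).trans (congrArg _ (hΨk s))
  · rw [hset]
    exact hclosed.preimage hkc
  · rw [hset]
    obtain ⟨e, he, hes, het, hesymm, hei⟩ := hι.exists_chart
    refine ⟨fun s _ => ⟨⟨X, e⟩, by rw [hes]; trivial, τ.invariants, he, hclosed, fun p _ => ?_⟩⟩
    have h1 := hei (k p) (hkΩ p)
    rw [hιk] at h1
    rw [h1]
    rfl
  · refine ⟨X, τ, Ω, ι, hτ, h0, hτΩ, hι, (hιΨ 0 h0).trans hΨ0, fun h v hv => ?_⟩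
    rw [hιΨ _ hv, hιΨ _ (hτΩ h v hv), hτΨ h v hv]

end Slice

/-! ### Balls of compatible metrics. -/

section Metrics

variable {X : Type u} [TopologicalSpace X] {d : X → X → ℝ}

theorem IsCompatibleMetric.isOpen_ball (h : IsCompatibleMetric d) (x : X) (ε : ℝ) :
    IsOpen {y | d x y < ε} := by
  refine (h.isOpen_iff _).2 fun y hy => ⟨ε - d x y, sub_pos.2 hy, fun z hz => ?_⟩
  have h1 := h.triangle x y z
  change d x z < ε
  linarith

theorem IsCompatibleMetric.ball_mem_nhds (h : IsCompatibleMetric d) (x : X) {ε : ℝ} (hε : 0 < ε) :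
    {y | d x y < ε} ∈ 𝓝 x :=
  (h.isOpen_ball x ε).mem_nhds (by simpa [h.self x] using hε)

theorem IsCompatibleMetric.exists_ball_subset (h : IsCompatibleMetric d) {x : X} {s : Set X}
    (hs : s ∈ 𝓝 x) : ∃ ε > 0, ∀ y, d x y < ε → y ∈ s := by
  obtain ⟨t, hts, ht, hxt⟩ := mem_nhds_iff.1 hs
  obtain ⟨ε, hε, h1⟩ := (h.isOpen_iff t).1 ht x hxt
  exact ⟨ε, hε, fun y hy => hts (h1 y hy)⟩

end Metrics

/-! ### Functoriality and linearity of the derivative of the action. -/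

section ActionDerivatives

variable {G : Type u} {M : Type v} [Group G] [TopologicalSpace G] [Manifold G]
  [TopologicalSpace M] [Manifold M] [MulAction G M]

/-- The chain rule for `x ↦ g' • (g • x)`. It makes the isotropy action a representation, and shows
that translations by `g` and `g⁻¹` are inverse on tangent vectors. -/
theorem IsSmoothAction.actDeriv_actDeriv (h : IsSmoothAction G M) {a b c : Chart M}
    (ha : a ∈ maximalAtlas M) (hb : b ∈ maximalAtlas M) (hc : c ∈ maximalAtlas M) (g g' : G)
    {p : M} (hpa : p ∈ a.map.source) (hpb : g • p ∈ b.map.source)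
    (hpc : (g' * g) • p ∈ c.map.source) (v : a.space) :
    actDeriv b c (g', (b.map (g • p), actDeriv a b (g, (a.map p, v)))) =
      actDeriv a c (g' * g, (a.map p, v)) := by
  have h1 := dirDeriv_localMap_comp isOpen_univ isOpen_univ (h.smoothOn_smul g univ)
    (h.smoothOn_smul g' univ) trivial trivial ha hpa hb hpb hc (by rwa [← mul_smul]) v
  simp only [← mul_smul] at h1
  exact h1

theorem actDeriv_one {c : Chart M} {x : c.space} (hx : x ∈ c.map.target) (v : c.space) :
    actDeriv c c ((1 : G), (x, v)) = v := by
  have e : localMap (fun y : M => (1 : G) • y) c c = c.change c := by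
    simp only [one_smul]
    rfl
  change dirDeriv (localMap (fun y : M => (1 : G) • y) c c) x v = v
  rw [e]
  exact dirDeriv_change_self hx v

theorem IsSmoothAction.isSmooth_localMap (h : IsSmoothAction G M) {c c' : Chart M}
    (hc : c ∈ maximalAtlas M) (hc' : c' ∈ maximalAtlas M) (g : G) :
    IsSmooth (localMap (fun x : M => g • x) c c')
      (c.map.target ∩ c.map.symm ⁻¹' (univ ∩ (fun x : M => g • x) ⁻¹' c'.map.source)) :=
  (h.smoothOn_smul g univ).isSmooth isOpen_univ hc hc'

theorem IsSmoothAction.actDeriv_add (h : IsSmoothAction G M) {c c' : Chart M}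
    (hc : c ∈ maximalAtlas M) (hc' : c' ∈ maximalAtlas M) (g : G) {x : c.space}
    (hx : x ∈ c.map.target) (hx' : g • c.map.symm x ∈ c'.map.source) (v w : c.space) :
    actDeriv c c' (g, (x, v + w)) = actDeriv c c' (g, (x, v)) + actDeriv c c' (g, (x, w)) :=
  (h.isSmooth_localMap hc hc' g).dirDeriv_add
    (isOpen_chartDomain isOpen_univ (h.smoothOn_smul g univ).1 c c') ⟨hx, trivial, hx'⟩ v w

theorem IsSmoothAction.actDeriv_smul (h : IsSmoothAction G M) {c c' : Chart M}
    (hc : c ∈ maximalAtlas M) (hc' : c' ∈ maximalAtlas M) (g : G) {x : c.space}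
    (hx : x ∈ c.map.target) (hx' : g • c.map.symm x ∈ c'.map.source) (r : ℝ) (v : c.space) :
    actDeriv c c' (g, (x, r • v)) = r • actDeriv c c' (g, (x, v)) :=
  (h.isSmooth_localMap hc hc' g).dirDeriv_smul ⟨hx, trivial, hx'⟩ r v

theorem dirDeriv_zero {E : LCSpace.{u}} {F : LCSpace.{v}} (f : E → F) (x : E) :
    dirDeriv f x 0 = 0 :=
  HasDirDeriv.eq (by simp [HasDirDeriv])

/-- The tangent map of the action, in terms of charts. -/
theorem IsSmoothAction.map_mk (h : IsSmoothAction G M) {c c' : Chart M}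
    (hc : c ∈ maximalAtlas M) (hc' : c' ∈ maximalAtlas M) (g : G) {x : c.space} {y : c'.space}
    (hx : x ∈ c.map.target) (hy : y ∈ c'.map.target) (hxy : g • c.map.symm x = c'.map.symm y)
    (v : c.space) :
    TangentBundle.map (fun p : M => g • p) ⟨c.map.symm x, c.derivSymm x v⟩ =
      ⟨c'.map.symm y, c'.derivSymm y (actDeriv c c' (g, (x, v)))⟩ := by
  have hy' := c'.map.map_target hy
  have hgx : g • c.map.symm x ∈ c'.map.source := by rwa [hxy]
  refine TangentBundle.ext_chart hc' (X := TangentBundle.map (fun p : M => g • p) _)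
    hgx hxy ?_
  have h1 := h.deriv_tangentMap hc hc' g (c.map.map_target hx) hgx (c.derivSymm x v)
  rw [Chart.deriv_derivSymm hc hc ⟨hx, c.map.map_target hx⟩, dirDeriv_change_self hx,
    c.map.right_inv hx] at h1
  refine h1.trans ?_
  rw [Chart.deriv_derivSymm hc' hc' ⟨hy, hy'⟩, dirDeriv_change_self hy]

/-- The base points agree only propositionally, so the two vectors are of different types and are
compared in the total space. -/
theorem TangentBundle.mk_chartAt (p : M) (v : TangentSpace p) :
    (⟨(chartAt p).map.symm ((chartAt p).map p), (chartAt p).derivSymm ((chartAt p).map p) v⟩ :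
      TangentBundle M) = ⟨p, v⟩ := by
  have e := ((chartAt p).tangentEquiv (atlas_subset_maximalAtlas (chartAt_mem p))).left_inv
    (x := ⟨p, v⟩) (mem_chartAt_source p)
  have e' : (chartAt p).tangentEquiv (atlas_subset_maximalAtlas (chartAt_mem p)) ⟨p, v⟩ =
    (((chartAt p).map p, v) : (chartAt p).space × (chartAt p).space) :=
    Prod.ext rfl (Chart.deriv_chartAt p v)
  rw [e'] at e
  exact e

end ActionDerivatives

/-! ### Local sections and coordinates on the orbit. -/

section OrbitParametrization

open MulAction

variable {G : Type u} {M : Type v} [Group G] [TopologicalSpace G] [Manifold G] [IsLieGroup G]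
  [TopologicalSpace M] [Manifold M] [MulAction G M]

/-- A principal bundle has a local section through the identity. -/
theorem IsPrincipalBundle.exists_section {H : Subgroup G} [IsSubmanifold (H : Set G)]
    [Manifold (G ⧸ H)] (h : IsPrincipalBundle H) :
    ∃ (U : Set (G ⧸ H)) (χ : G ⧸ H → G), ((1 : G) : G ⧸ H) ∈ U ∧ IsLocalSection χ U ∧
      χ ((1 : G) : G ⧸ H) = 1 := by
  obtain ⟨U, χ, h1, hχ, -⟩ := h.locally_trivial ((1 : G) : G ⧸ H)
  have h2 : (χ ((1 : G) : G ⧸ H))⁻¹ ∈ H := by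
    have := QuotientGroup.eq.1 (hχ.mk_eq _ h1)
    simpa using this
  -- Right multiplication by an element of `H` leaves cosets unchanged, so the section can be
  -- normalized to take the value `1` at the identity coset.
  refine ⟨U, fun q => χ q * (χ ((1 : G) : G ⧸ H))⁻¹, h1, ⟨hχ.isOpen,
    hχ.smoothOn.mul hχ.isOpen (smoothOn_const _ _), fun q hq => ?_⟩, mul_inv_cancel _⟩
  refine Eq.trans ?_ (hχ.mk_eq q hq)
  exact QuotientGroup.mk_mul_of_mem _ h2

variable {m : M} [IsSubmanifold (stabilizer G m : Set G)] [Manifold (G ⧸ stabilizer G m)]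
  [IsSubmanifold (orbit G m)]

/-- A slice chart of the orbit defines a parametrization of the orbit by elements of the group. -/
theorem IsOrbitMapDiffeo.exists_param (h : IsOrbitMapDiffeo G m)
    (hprincipal : IsPrincipalBundle (stabilizer G m)) {c : Chart M} {F : Submodule ℝ c.space}
    (hc : IsSliceChart (orbit G m) c F) (hm : m ∈ c.map.source) :
    ∃ (U : Set (G ⧸ stabilizer G m)) (χ : G ⧸ stabilizer G m → G)
      (ξ : G ⧸ stabilizer G m → c.space.sub F) (W : Set (c.space.sub F)),
      ((1 : G) : G ⧸ stabilizer G m) ∈ U ∧ IsLocalSection χ U ∧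
      χ ((1 : G) : G ⧸ stabilizer G m) = 1 ∧ IsDiffeoOn ξ U W ∧
      (ξ ((1 : G) : G ⧸ stabilizer G m)).val = c.map m ∧
      ∀ q ∈ U, (ξ q).val ∈ c.map.target ∧ χ q • m = c.map.symm (ξ q).val := by
  obtain ⟨U₀, χ, h1, hχ, hχ1⟩ := hprincipal.exists_section
  let o : orbit G m := ⟨m, mem_orbit_self m⟩
  let d : Chart (orbit G m) := hc.restrict o
  have hd : d ∈ maximalAtlas (orbit G m) := atlas_subset_maximalAtlas ⟨c, F, hc, o, rfl⟩
  let θ : G ⧸ stabilizer G m → orbit G m := fun q => (orbitEquivQuotientStabilizer G m).symm q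
  have hθ : ∀ g : G, (θ g : M) = g • m := fun g => orbitEquivQuotientStabilizer_symm_apply G m g
  have hdθ : IsDiffeoOn (fun q => d.map (θ q)) (univ ∩ θ ⁻¹' d.map.source) d.map.target := by
    have h2 := IsDiffeoOn.restrict_preimage h d.map.open_source (subset_univ _)
    refine IsDiffeoOn.comp ?_ h2
    exact (Chart.isDiffeoOn_symm hd).symm_of_invOn
      ⟨fun x hx => d.map.right_inv hx, fun x hx => d.map.left_inv hx⟩
  have hUo : IsOpen (U₀ ∩ (univ ∩ θ ⁻¹' d.map.source)) := hχ.isOpen.inter hdθ.isOpen_source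
  have h1' : ((1 : G) : G ⧸ stabilizer G m) ∈ U₀ ∩ (univ ∩ θ ⁻¹' d.map.source) := by
    refine ⟨h1, trivial, ?_⟩
    change (θ ((1 : G) : G ⧸ stabilizer G m) : M) ∈ c.map.source
    rw [hθ, one_smul]
    exact hm
  refine ⟨U₀ ∩ (univ ∩ θ ⁻¹' d.map.source), χ, fun q => d.map (θ q), _, h1',
    ⟨hUo, hχ.smoothOn.mono inter_subset_left, fun q hq => hχ.mk_eq q hq.1⟩, hχ1,
    hdθ.restrict_image hUo inter_subset_right, ?_, fun q hq => ⟨?_, ?_⟩⟩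
  · refine (hc.homeo_apply o h1'.2.2).trans ?_
    rw [hθ, one_smul]
  · exact d.map.map_source hq.2.2
  · have h3 : ((d.map (θ q)).val : c.space) = c.map (θ q) := hc.homeo_apply o hq.2.2
    have h4 : (θ q : M) ∈ c.map.source := hq.2.2
    rw [h3, c.map.left_inv h4]
    conv_rhs => rw [← hχ.mk_eq q hq.1]
    rw [hθ]

/-- Group elements which move `m` only a little are close to the stabilizer of `m`. -/
theorem IsOrbitMapDiffeo.exists_nhds (h : IsOrbitMapDiffeo G m) {U : Set (G ⧸ stabilizer G m)}
    (hU : IsOpen U) (h1 : ((1 : G) : G ⧸ stabilizer G m) ∈ U) :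
    ∃ V ∈ 𝓝 m, ∀ g : G, g • m ∈ V → (g : G ⧸ stabilizer G m) ∈ U := by
  obtain ⟨k, hk, hks, -⟩ := h.exists_inv
  let o : orbit G m := ⟨m, mem_orbit_self m⟩
  have hkg : ∀ g : G, k ⟨g • m, mem_orbit m g⟩ = (g : G ⧸ stabilizer G m) := by
    intro g
    have h2 := hk.1 (mem_univ (g : G ⧸ stabilizer G m))
    have h3 : (orbitEquivQuotientStabilizer G m).symm (g : G ⧸ stabilizer G m) =
        ⟨g • m, mem_orbit m g⟩ := Subtype.ext (orbitEquivQuotientStabilizer_symm_apply G m g)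
    rw [← h2]
    exact congrArg k h3.symm
  have hko : k o = ((1 : G) : G ⧸ stabilizer G m) := by
    rw [← hkg 1]
    exact congrArg k (Subtype.ext (one_smul G m).symm)
  have h4 : k ⁻¹' U ∈ 𝓝 o :=
    (continuousOn_univ.1 hks.1).continuousAt.preimage_mem_nhds (hU.mem_nhds (hko ▸ h1))
  obtain ⟨V, hV, hVU⟩ := mem_nhds_subtype _ _ _ |>.1 h4
  refine ⟨V, hV, fun g hg => ?_⟩
  rw [← hkg g]
  exact hVU (show ((⟨g • m, mem_orbit m g⟩ : orbit G m) : M) ∈ V from hg)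

end OrbitParametrization

/-! ### The isotropy representation and the frame of the normal bundle. -/

section NormalRepresentation

open MulAction

variable {G : Type u} {M : Type v} [Group G] [TopologicalSpace G] [Manifold G]
  [TopologicalSpace M] [Manifold M] [MulAction G M]

/-- This is the field `mem_iff` of `κ` read at a coordinate `x` instead of a point of `P`, as needed
for vectors given by their chart representation `u`. -/
theorem SubbundleChart.derivSymm_mem_iff {P : Set M} {N : ∀ p : M, Submodule ℝ (TangentSpace p)}
    (κ : SubbundleChart P N) {x : κ.chart.space.sub κ.F} (hx : x.val ∈ κ.chart.map.target)
    (hP : κ.chart.map.symm x.val ∈ P) (u : κ.chart.space) :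
    κ.chart.derivSymm x.val u ∈ N (κ.chart.map.symm x.val) ↔ κ.triv x u ∈ κ.E₀ := by
  have hc := κ.isSliceChart.mem_maximalAtlas
  have hs := κ.chart.map.map_target hx
  rw [κ.mem_iff _ hs hP, Chart.deriv_derivSymm hc hc ⟨hx, hs⟩, dirDeriv_change_self hx]
  have e : (⟨κ.chart.map (κ.chart.map.symm x.val), (κ.isSliceChart.mem_iff _ hs).1 hP⟩ :
      κ.chart.space.sub κ.F) = x := Subtype.ext (κ.chart.map.right_inv hx)
  rw [e]

/-- The linear action of the stabilizer of `m` on an invariant subspace of the tangent space. -/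
theorem IsSmoothAction.exists_representation (h : IsSmoothAction G M) {m : M}
    (N : Submodule ℝ (TangentSpace m))
    (hN : ∀ g : G, ∀ v ∈ N, ∀ w : TangentSpace m,
      TangentBundle.map (fun x : M => g • x) ⟨m, v⟩ = ⟨m, w⟩ → w ∈ N) :
    ∃ τ : Representation ℝ (stabilizer G m) ((TangentSpace m).sub N),
      (Continuous fun z : stabilizer G m × (TangentSpace m).sub N => τ z.1 z.2) ∧
      ∀ (g : stabilizer G m) (v : (TangentSpace m).sub N),
        TangentBundle.map (fun x : M => (g : G) • x) ⟨m, v.val⟩ = ⟨m, (τ g v).val⟩ := by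
  let k : Chart M := chartAt m
  have hk : k ∈ maximalAtlas M := atlas_subset_maximalAtlas (chartAt_mem m)
  have hmk : m ∈ k.map.source := mem_chartAt_source m
  let y := k.map m
  have hy : y ∈ k.map.target := k.map.map_source hmk
  have hgy : ∀ g : stabilizer G m, (g : G) • k.map.symm y = k.map.symm y := fun g => by
    simp only [y, k.map.left_inv hmk]
    exact g.2
  have hgy' : ∀ g : stabilizer G m, (g : G) • k.map.symm y ∈ k.map.source := fun g => by
    rw [hgy]
    exact k.map.map_target hy
  have hmap : ∀ (g : stabilizer G m) (v : TangentSpace m),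
      TangentBundle.map (fun x : M => (g : G) • x) ⟨m, v⟩ =
        ⟨m, actDeriv k k ((g : G), (y, v))⟩ := by
    intro g v
    have h1 := h.map_mk hk hk (g : G) hy hy (hgy g) v
    have h2 := TangentBundle.mk_chartAt m v
    have h3 := TangentBundle.mk_chartAt m (actDeriv k k ((g : G), (y, v)))
    exact (congrArg _ h2.symm).trans (h1.trans h3)
  have hmem : ∀ (g : stabilizer G m) (v : (TangentSpace m).sub N),
      actDeriv k k ((g : G), (y, v.val)) ∈ N := fun g v => hN g v.val v.2 _ (hmap g v.val)
  let τ : Representation ℝ (stabilizer G m) ((TangentSpace m).sub N) :=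
    { toFun := fun g =>
        { toFun := fun v => ⟨actDeriv k k ((g : G), (y, v.val)), hmem g v⟩
          map_add' := fun v w =>
            Subtype.ext (h.actDeriv_add hk hk (g : G) hy (hgy' g) v.val w.val)
          map_smul' := fun r v =>
            Subtype.ext (h.actDeriv_smul hk hk (g : G) hy (hgy' g) r v.val) }
      map_one' := LinearMap.ext fun v => Subtype.ext (actDeriv_one hy v.val)
      map_mul' := fun a b => LinearMap.ext fun v => Subtype.ext (by
        have hb : (b : G) • m = m := b.2
        have hab : ((a : G) * b) • m = m := (a * b).2
        have h1 := h.actDeriv_actDeriv hk hk hk (b : G) (a : G) hmk (by rwa [hb])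
          (by rwa [hab]) v.val
        rw [hb] at h1
        exact h1.symm) }
  refine ⟨τ, ?_, fun g v => hmap g v.val⟩
  refine Continuous.subtype_mk ?_ _
  refine (h.smoothOn_actDeriv hk hk).continuousOn.comp_continuous
    (f := fun z : stabilizer G m × (TangentSpace m).sub N => ((z.1 : G), (y, z.2.val))) ?_
    fun z => ⟨hy, hgy' z.1⟩
  exact (continuous_subtype_val.comp continuous_fst).prodMk
    (continuous_const.prodMk (continuous_subtype_val.comp continuous_snd))

variable [IsLieGroup G]

/-- Moving normal vectors at `m` along the orbit trivializes the normal bundle. -/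
theorem SubbundleChart.exists_frame (h : IsSmoothAction G M) {m : M}
    {N : ∀ p : M, Submodule ℝ (TangentSpace p)} (hNc : IsClosed (N m : Set (TangentSpace m)))
    (hNinv : ∀ g : G, ∀ X : TangentBundle M, X.proj ∈ orbit G m → X.vec ∈ N X.proj →
      (TangentBundle.map (fun x : M => g • x) X).vec ∈ N (g • X.proj))
    (κ : SubbundleChart (orbit G m) N) {g : κ.chart.space.sub κ.F → G}
    {W : Set (κ.chart.space.sub κ.F)} (hW : IsOpen W) (hg : SmoothOn g W)
    (hgW : ∀ x ∈ W, x.val ∈ κ.chart.map.target ∧ g x • m = κ.chart.map.symm x.val) :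
    ∃ Θ : κ.chart.space.sub κ.F × (TangentSpace m).sub (N m) →
        κ.chart.space.sub κ.F × κ.chart.space.sub κ.E₀,
      IsDiffeoOn Θ (W ×ˢ univ) (W ×ˢ univ) ∧ (∀ x ∈ W, Θ (x, 0) = (x, 0)) ∧
      ∀ x ∈ W, ∀ v : (TangentSpace m).sub (N m),
        κ.param (Θ (x, v)) = TangentBundle.map (fun p : M => g x • p) ⟨m, v.val⟩ := by
  classical
  let k : Chart M := chartAt m
  have hk : k ∈ maximalAtlas M := atlas_subset_maximalAtlas (chartAt_mem m)
  have hmk : m ∈ k.map.source := mem_chartAt_source m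
  let y := k.map m
  have hy : y ∈ k.map.target := k.map.map_source hmk
  have hky : k.map.symm y = m := k.map.left_inv hmk
  let c := κ.chart
  have hc : c ∈ maximalAtlas M := κ.isSliceChart.mem_maximalAtlas
  have hginv : ∀ x ∈ W, (g x)⁻¹ • c.map.symm x.val = m := fun x hx => by
    rw [← (hgW x hx).2, inv_smul_smul]
  have horb : ∀ x ∈ W, c.map.symm x.val ∈ orbit G m := fun x hx => ⟨g x, (hgW x hx).2⟩
  -- `A` expresses the translate of `v` by `g x` in the chart `c`. `B` translates a vector over `x`
  -- back to `T_m M` by `(g x)⁻¹`. Invariance of `N` makes them inverse bijections between the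
  -- normal fibres.
  let A : c.space.sub κ.F × (TangentSpace m).sub (N m) → c.space := fun q =>
    actDeriv k c (g q.1, (y, q.2.val))
  let B : c.space.sub κ.F × c.space → TangentSpace m := fun q =>
    actDeriv c k ((g q.1)⁻¹, (q.1.val, q.2))
  have hmapA : ∀ x ∈ W, ∀ v : (TangentSpace m).sub (N m),
      TangentBundle.map (fun p : M => g x • p) ⟨m, v.val⟩ =
        ⟨c.map.symm x.val, c.derivSymm x.val (A (x, v))⟩ := by
    intro x hx v
    have h1 := h.map_mk hk hc (g x) hy (hgW x hx).1 (by rw [hky]; exact (hgW x hx).2) v.val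
    exact (congrArg _ (TangentBundle.mk_chartAt m v.val).symm).trans h1
  have hmapB : ∀ x ∈ W, ∀ u : c.space,
      TangentBundle.map (fun p : M => (g x)⁻¹ • p) ⟨c.map.symm x.val, c.derivSymm x.val u⟩ =
        ⟨m, B (x, u)⟩ := by
    intro x hx u
    have h1 := h.map_mk hc hk (g x)⁻¹ (hgW x hx).1 hy (by rw [hky]; exact hginv x hx) u
    exact h1.trans (TangentBundle.mk_chartAt m (B (x, u)))
  have hBA : ∀ x ∈ W, ∀ v : (TangentSpace m).sub (N m), B (x, A (x, v)) = v.val := by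
    intro x hx v
    have h1 := h.actDeriv_actDeriv hk hc hk (g x) (g x)⁻¹ hmk
      (by rw [(hgW x hx).2]; exact c.map.map_target (hgW x hx).1)
      (by rwa [inv_mul_cancel, one_smul]) v.val
    rw [(hgW x hx).2, c.map.right_inv (hgW x hx).1, inv_mul_cancel] at h1
    exact h1.trans (actDeriv_one hy v.val)
  have hAB : ∀ x ∈ W, ∀ u : c.space, actDeriv k c (g x, (y, B (x, u))) = u := by
    intro x hx u
    have h1 := h.actDeriv_actDeriv hc hk hc (g x)⁻¹ (g x) (c.map.map_target (hgW x hx).1)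
      (by rwa [hginv x hx])
      (by rw [mul_inv_cancel, one_smul]; exact c.map.map_target (hgW x hx).1) u
    rw [hginv x hx, mul_inv_cancel, c.map.right_inv (hgW x hx).1,
      actDeriv_one (hgW x hx).1] at h1
    exact h1
  have hmemA : ∀ x ∈ W, ∀ v : (TangentSpace m).sub (N m), κ.triv x (A (x, v)) ∈ κ.E₀ := by
    intro x hx v
    rw [← κ.derivSymm_mem_iff (hgW x hx).1 (horb x hx)]
    have h1 := hNinv (g x) ⟨m, v.val⟩ (mem_orbit_self m) v.2
    -- Membership in the fibre over `Y.proj` is transported along an equality of bundle points,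
    -- since the two base points agree only propositionally.
    have key : ∀ Y : TangentBundle M,
        TangentBundle.map (fun p : M => g x • p) ⟨m, v.val⟩ = Y → Y.vec ∈ N Y.proj := by
      rintro _ rfl
      exact h1
    exact key _ (hmapA x hx v)
  have hmemB : ∀ x ∈ W, ∀ w : c.space.sub κ.E₀, B (x, (κ.triv x).symm w.val) ∈ N m := by
    intro x hx w
    have h1 : c.derivSymm x.val ((κ.triv x).symm w.val) ∈ N (c.map.symm x.val) := by
      rw [κ.derivSymm_mem_iff (hgW x hx).1 (horb x hx), ContinuousLinearEquiv.apply_symm_apply]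
      exact w.2
    have h2 := hNinv (g x)⁻¹ ⟨c.map.symm x.val, c.derivSymm x.val ((κ.triv x).symm w.val)⟩
      (horb x hx) h1
    have key : ∀ X Y : TangentBundle M, (TangentBundle.map (fun p : M => (g x)⁻¹ • p) X).vec ∈
        N ((g x)⁻¹ • X.proj) → TangentBundle.map (fun p : M => (g x)⁻¹ • p) X = Y →
        Y.vec ∈ N Y.proj := by
      rintro X _ h3 rfl
      exact h3
    exact key _ _ h2 (hmapB x hx _)
  -- The value `0` is taken only where membership in `E₀` fails, hence never over `W`.
  let Θ : c.space.sub κ.F × (TangentSpace m).sub (N m) → c.space.sub κ.F × c.space.sub κ.E₀ :=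
    fun q => (q.1, if hq : κ.triv q.1 (A q) ∈ κ.E₀ then ⟨_, hq⟩ else 0)
  let Θ' : c.space.sub κ.F × c.space.sub κ.E₀ → c.space.sub κ.F × (TangentSpace m).sub (N m) :=
    fun q => (q.1, if hq : B (q.1, (κ.triv q.1).symm q.2.val) ∈ N m then ⟨_, hq⟩ else 0)
  have hΘ : ∀ x, ∀ hx : x ∈ W, ∀ v, Θ (x, v) = (x, ⟨_, hmemA x hx v⟩) := fun x hx v =>
    Prod.ext rfl (dif_pos (hmemA x hx v))
  have hΘ' : ∀ x, ∀ hx : x ∈ W, ∀ w, Θ' (x, w) = (x, ⟨_, hmemB x hx w⟩) := fun x hx w =>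
    Prod.ext rfl (dif_pos (hmemB x hx w))
  have hWo : IsOpen (W ×ˢ (univ : Set ((TangentSpace m).sub (N m)))) := hW.prod isOpen_univ
  have hWo' : IsOpen (W ×ˢ (univ : Set (c.space.sub κ.E₀))) := hW.prod isOpen_univ
  have hto : IsOpen {q : c.space.sub κ.F × c.space | q.1.val ∈ c.map.target} :=
    c.map.open_target.preimage (continuous_subtype_val.comp continuous_fst)
  have hval : ∀ {E : LCSpace.{v}} (K : Submodule ℝ E), SmoothOn (fun x : E.sub K => x.val) univ :=
    fun {E} K => smoothOn_iff_isSmooth.2 (isSmooth_clm (E := E.sub K) K.subtypeL univ)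
  refine ⟨Θ, IsDiffeoOn.of_invOn (g := Θ') hWo hWo' ?_ ?_ (fun q hq => ⟨hq.1, trivial⟩)
    (fun q hq => ⟨hq.1, trivial⟩) ⟨?_, ?_⟩, ?_, ?_⟩
  · refine (smoothOn_fst _).prodMk hWo ((smoothOn_subspace_iff κ.isClosed hWo).2 ?_)
    have h1 : SmoothOn A (W ×ˢ univ) := by
      refine (h.smoothOn_actDeriv hk hc).comp (h.isOpen_actDeriv_domain k c) hWo
        (f := fun q : c.space.sub κ.F × (TangentSpace m).sub (N m) => (g q.1, (y, q.2.val)))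
        ?_ ?_
      · exact (hg.comp hW hWo (smoothOn_fst _) fun q hq => hq.1).prodMk hWo
          ((smoothOn_const y _).prodMk hWo
            ((hval (N m)).comp isOpen_univ hWo (smoothOn_snd _) fun _ _ => trivial))
      · rintro ⟨x, v⟩ ⟨hx, -⟩
        refine ⟨hy, ?_⟩
        change g x • k.map.symm y ∈ c.map.source
        rw [hky, (hgW x hx).2]
        exact c.map.map_target (hgW x hx).1
    have h2 := (smoothOn_prod_iff_isSmooth.2 κ.smooth_triv).comp hto hWo
      ((smoothOn_fst _).prodMk hWo h1) fun q hq => (hgW q.1 hq.1).1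
    refine h2.congr hWo ?_
    rintro ⟨x, v⟩ ⟨hx, -⟩
    exact (congrArg (fun q => q.2.val) (hΘ x hx v)).symm
  · refine (smoothOn_fst _).prodMk hWo' ((smoothOn_subspace_iff hNc hWo').2 ?_)
    have h1 := (smoothOn_prod_iff_isSmooth.2 κ.smooth_triv_symm).comp hto hWo'
      ((smoothOn_fst _).prodMk hWo' ((hval κ.E₀).comp isOpen_univ hWo' (smoothOn_snd _)
        fun _ _ => trivial)) fun q hq => (hgW q.1 hq.1).1
    have h2 : SmoothOn (fun q : c.space.sub κ.F × c.space.sub κ.E₀ =>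
        B (q.1, (κ.triv q.1).symm q.2.val)) (W ×ˢ univ) := by
      refine (h.smoothOn_actDeriv hc hk).comp (h.isOpen_actDeriv_domain c k) hWo'
        (f := fun q : c.space.sub κ.F × c.space.sub κ.E₀ =>
          ((g q.1)⁻¹, (q.1.val, (κ.triv q.1).symm q.2.val))) ?_ ?_
      · exact ((hg.comp hW hWo' (smoothOn_fst _) fun q hq => hq.1).inv hWo').prodMk hWo'
          (((hval κ.F).comp isOpen_univ hWo' (smoothOn_fst _) fun _ _ => trivial).prodMk hWo' h1)
      · rintro ⟨x, w⟩ ⟨hx, -⟩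
        refine ⟨(hgW x hx).1, ?_⟩
        change (g x)⁻¹ • c.map.symm x.val ∈ k.map.source
        rwa [hginv x hx]
    refine h2.congr hWo' ?_
    rintro ⟨x, w⟩ ⟨hx, -⟩
    exact (congrArg (fun q => q.2.val) (hΘ' x hx w)).symm
  · rintro ⟨x, v⟩ ⟨hx, -⟩
    refine (congrArg Θ' (hΘ x hx v)).trans ((hΘ' x hx _).trans (Prod.ext rfl (Subtype.ext ?_)))
    change B (x, (κ.triv x).symm (κ.triv x (A (x, v)))) = v.val
    rw [ContinuousLinearEquiv.symm_apply_apply, hBA x hx]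
  · rintro ⟨x, w⟩ ⟨hx, -⟩
    refine (congrArg Θ (hΘ' x hx w)).trans ((hΘ x hx _).trans (Prod.ext rfl (Subtype.ext ?_)))
    change κ.triv x (actDeriv k c (g x, (y, B (x, (κ.triv x).symm w.val)))) = w.val
    rw [hAB x hx, ContinuousLinearEquiv.apply_symm_apply]
  · intro x hx
    rw [hΘ x hx]
    refine Prod.ext rfl (Subtype.ext ?_)
    exact (congrArg (κ.triv x) (dirDeriv_zero _ _)).trans (map_zero _)
  · intro x hx v
    rw [hΘ x hx, hmapA x hx]
    change TangentBundle.mk _ _ = _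
    rw [ContinuousLinearEquiv.symm_apply_apply]

end NormalRepresentation

end LC

/-! ### Construction of the tube and choice of the radius. -/

theorem mainTheorem1 {G : Type*} {M : Type*}
    [Group G] [TopologicalSpace G] [LC.Manifold G] [LC.IsLieGroup G]
    [TopologicalSpace M] [LC.Manifold M] [MulAction G M]
    (hsmooth : LC.IsSmoothAction G M) (hproper : LC.IsProperAction G M) (m : M)
    -- the stabilizer is a principal Lie subgroup
    [LC.IsSubmanifold (MulAction.stabilizer G m : Set G)]
    [LC.Manifold (G ⧸ MulAction.stabilizer G m)]
    (hprincipal : LC.IsPrincipalBundle (MulAction.stabilizer G m))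
    -- the orbit is a locally closed submanifold
    [LC.IsSubmanifold (MulAction.orbit G m)]
    (hclosed : IsLocallyClosed (MulAction.orbit G m))
    (horbit : LC.IsOrbitMapDiffeo G m)
    -- its normal bundle is realized as a smooth invariant subbundle
    (N : ∀ p : M, Submodule ℝ (LC.TangentSpace p))
    (hN : LC.IsSmoothSubbundle (MulAction.orbit G m) N)
    (hNcompl : LC.IsNormalComplement (MulAction.orbit G m) N)
    (hNinv : ∀ g : G, ∀ p ∈ MulAction.orbit G m, ∀ v ∈ N p,
      LC.tangentMap (fun x : M => g • x) p v ∈ N (g • p))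
    -- the equivariant local addition, adapted to the orbit
    (U : Set (LC.TangentBundle M)) (η : LC.TangentBundle M → M)
    (hη : LC.IsLocalAddition U η)
    (hUinv : ∀ g : G, ∀ X ∈ U, LC.TangentBundle.map (fun x : M => g • x) X ∈ U)
    (hηequiv : ∀ g : G, ∀ X ∈ U, η (LC.TangentBundle.map (fun x : M => g • x) X) = g • η X)
    (hadapted : LC.IsAdapted η (MulAction.orbit G m) N)
    -- the invariant metric on `M` and the invariant fiber metric on `TM`
    (d : M → M → ℝ) (hd : LC.IsCompatibleMetric d)
    (hdinv : ∀ (g : G) (x y : M), d (g • x) (g • y) = d x y)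
    (ρ : ∀ p : M, LC.TangentSpace p → LC.TangentSpace p → ℝ)
    (hρ : ∀ p : M, LC.IsCompatibleMetric (ρ p))
    (hρinv : ∀ (g : G) (p : M) (v w : LC.TangentSpace p),
      ρ (g • p) (LC.tangentMap (fun x : M => g • x) p v)
        (LC.tangentMap (fun x : M => g • x) p w) = ρ p v w) :
    ∃ ε : ℝ, 0 < ε ∧ (∀ v ∈ N m, ρ m v 0 < ε → LC.TangentBundle.mk m v ∈ U) ∧
      LC.IsLinearSlice G m {x : M | ∃ v ∈ N m, ρ m v 0 < ε ∧ η (LC.TangentBundle.mk m v) = x} := by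
  open LC MulAction in
  have hmO : m ∈ orbit G m := mem_orbit_self m
  -- `N m` is the fixed set of a continuous projection. Closedness is needed for smoothness of maps
  -- into it.
  have hNc : IsClosed (N m : Set (TangentSpace m)) := by
    obtain ⟨π, h1, h2, -⟩ := hNcompl m hmO
    have e : (N m : Set (TangentSpace m)) = {v | π v = v} := by
      ext v
      exact ⟨h2 v, fun hv => hv ▸ h1 v⟩
    rw [e]
    exact isClosed_eq π.continuous continuous_id
  have hNinv' : ∀ g : G, ∀ X : TangentBundle M, X.proj ∈ orbit G m → X.vec ∈ N X.proj →
      (TangentBundle.map (fun x : M => g • x) X).vec ∈ N (g • X.proj) := fun g X hX hv =>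
    hNinv g X.proj hX X.vec hv
  have hRinv : ∀ (g : G) (X : TangentBundle M),
      ρ (g • X.proj) (TangentBundle.map (fun x : M => g • x) X).vec 0 = ρ X.proj X.vec 0 := by
    intro g X
    have h1 := hρinv g X.proj X.vec 0
    have h2 : tangentMap (fun x : M => g • x) X.proj 0 = 0 := dirDeriv_zero _ _
    rw [h2] at h1
    exact h1
  obtain ⟨τ, hτ, hτmap⟩ := hsmooth.exists_representation (N m) (by
    intro g v hv w hw
    have key : ∀ Y : TangentBundle M,
        TangentBundle.map (fun x : M => g • x) ⟨m, v⟩ = Y → Y.vec ∈ N Y.proj := by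
      rintro _ rfl
      exact hNinv' g ⟨m, v⟩ hmO hv
    exact key _ hw)
  have hτρ : ∀ h v, ρ m (τ h v).val 0 = ρ m v.val 0 := by
    intro h v
    have key : ∀ Y : TangentBundle M, TangentBundle.map (fun x : M => (h : G) • x) ⟨m, v.val⟩ = Y →
        ρ Y.proj Y.vec 0 = ρ m v.val 0 := by
      rintro _ rfl
      exact hRinv h ⟨m, v.val⟩
    exact key _ (hτmap h v)
  obtain ⟨κ, hmc, A, B, hA, hdiff⟩ := hadapted m hmO
  obtain ⟨U₀, χ, ξ, W₀, h1U, hχ, hχ1, hξ, hξ1, hχξ⟩ :=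
    horbit.exists_param hprincipal κ.isSliceChart hmc
  obtain ⟨ξ', hξ', hξ's, hξ'm⟩ := hξ.exists_inv
  have hg : SmoothOn (fun x => χ (ξ' x)) W₀ :=
    hχ.smoothOn.comp hχ.isOpen hξ.isOpen_target hξ's hξ'm
  obtain ⟨Θ, hΘ, hΘ0, hΘmap⟩ := κ.exists_frame hsmooth hNc hNinv' hξ.isOpen_target hg
    fun x hx => by
      have h1 := hχξ _ (hξ'm hx)
      rwa [hξ'.2 hx] at h1
  set x₁ := ξ ((1 : G) : G ⧸ stabilizer G m) with hx₁
  have hx₁W : x₁ ∈ W₀ := hξ.bijOn.mapsTo h1U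
  have hx₁A : ((x₁, 0) : κ.chart.space.sub κ.F × κ.chart.space.sub κ.E₀) ∈ A := by
    have e : x₁ = ⟨κ.chart.map m, (κ.isSliceChart.mem_iff m hmc).1 hmO⟩ := Subtype.ext hξ1
    rw [e]
    exact hA
  -- `κ.param (Θ (x, v))` is the translate of `v` by `χ (ξ' x)`. Adaptedness gives the local
  -- diffeomorphism property, the frame gives equivariance.
  let Ψ : κ.chart.space.sub κ.F × (TangentSpace m).sub (N m) → M := fun q => η (κ.param (Θ q))
  have hΨη : ∀ x ∈ W₀, ∀ v : (TangentSpace m).sub (N m), TangentBundle.mk m v.val ∈ U →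
      Ψ (x, v) = χ (ξ' x) • η ⟨m, v.val⟩ := by
    intro x hx v hv
    rw [← hηequiv _ _ hv]
    exact congrArg η (hΘmap x hx v)
  have hξ'1 : ξ' x₁ = ((1 : G) : G ⧸ stabilizer G m) := hξ'.1 h1U
  have hΨ1 : ∀ v : (TangentSpace m).sub (N m), TangentBundle.mk m v.val ∈ U →
      Ψ (x₁, v) = η ⟨m, v.val⟩ := by
    intro v hv
    rw [hΨη x₁ hx₁W v hv, hξ'1, hχ1, one_smul]
  have hΨ0 : Ψ (x₁, 0) = m := (hΨ1 0 (hη.zero_mem m)).trans (hη.map_zero m)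
  have hAo : IsOpen (A ∩ W₀ ×ˢ univ) := hdiff.isOpen_source.inter hΘ.isOpen_target
  have hΨd : IsDiffeoOn Ψ ((W₀ ×ˢ univ) ∩ Θ ⁻¹' (A ∩ W₀ ×ˢ univ)) _ := (hdiff.restrict_image hAo inter_subset_left).comp
    (hΘ.restrict_preimage hAo inter_subset_right)
  have h0mem : ((x₁, 0) : κ.chart.space.sub κ.F × (TangentSpace m).sub (N m)) ∈
      (W₀ ×ˢ univ) ∩ Θ ⁻¹' (A ∩ W₀ ×ˢ univ) := by
    refine ⟨⟨hx₁W, trivial⟩, ?_⟩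
    rw [mem_preimage, hΘ0 x₁ hx₁W]
    exact ⟨hx₁A, hx₁W, trivial⟩
  obtain ⟨W, Ω₁, hW, hxW, hΩ₁, h0Ω₁, hWΩ⟩ :=
    mem_nhds_prod_iff'.1 (hΨd.isOpen_source.mem_nhds h0mem)
  have hWW₀ : W ⊆ W₀ := fun x hx => (hWΩ (show (x, 0) ∈ W ×ˢ Ω₁ from ⟨hx, h0Ω₁⟩)).1.1
  have hξW := hξ.restrict_preimage hW hWW₀
  have h1U' : ((1 : G) : G ⧸ stabilizer G m) ∈ U₀ ∩ ξ ⁻¹' W := ⟨h1U, hxW⟩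
  obtain ⟨V, hV, hVU⟩ := horbit.exists_nhds hξW.isOpen_source h1U'
  obtain ⟨δ, hδ, hδV⟩ := hd.exists_ball_subset hV
  -- The bound is `δ / 2` because two slice points, `s` and `g • s`, enter the estimate of `d m (g •
  -- m)`.
  have hT : {v : (TangentSpace m).sub (N m) | v ∈ Ω₁ ∧ TangentBundle.mk m v.val ∈ U ∧
      d m (Ψ (x₁, v)) < δ / 2} ∈ 𝓝 0 := by
    have h1 : ContinuousAt (fun v => Ψ (x₁, v)) 0 :=
      (hΨd.smoothOn.1.continuousAt (hΨd.isOpen_source.mem_nhds h0mem)).comp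
        (f := fun v => (x₁, v)) (Continuous.prodMk continuous_const continuous_id).continuousAt
    have h2 := h1.preimage_mem_nhds (by rw [hΨ0]; exact hd.ball_mem_nhds m (half_pos hδ))
    have h3 : IsOpen {v : (TangentSpace m).sub (N m) | TangentBundle.mk m v.val ∈ U} :=
      (isOpen_tangentSpace_preimage hη.isOpen m).preimage continuous_subtype_val
    filter_upwards [hΩ₁.mem_nhds h0Ω₁, h3.mem_nhds (hη.zero_mem m), h2] with v hv1 hv2 hv3
    exact ⟨hv1, hv2, hv3⟩
  -- The metric `ρ m` lives on all of `T_m M`, so the neighbourhood in `N m` is first extended to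
  -- one in `T_m M`.
  obtain ⟨T, hT0, hT⟩ := (mem_nhds_subtype _ _ _).1 hT
  obtain ⟨ε, hε, hεT⟩ := (hρ m).exists_ball_subset (x := 0) hT0
  let Ω : Set ((TangentSpace m).sub (N m)) := {v | ρ m v.val 0 < ε}
  have hΩmem : ∀ v ∈ Ω, v ∈ Ω₁ ∧ TangentBundle.mk m v.val ∈ U ∧ d m (Ψ (x₁, v)) < δ / 2 :=
    fun v hv => hT (hεT v.val (by rw [(hρ m).comm]; exact hv))
  have hΩo : IsOpen Ω := by
    have h1 := ((hρ m).isOpen_ball 0 ε).preimage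
      (continuous_subtype_val (p := fun v => v ∈ N m))
    have e : Ω = (fun v => v.val) ⁻¹' {y | ρ m 0 y < ε} := Set.ext fun v => by
      change ρ m v.val 0 < ε ↔ ρ m 0 v.val < ε
      rw [(hρ m).comm]
    rw [e]
    exact h1
  have h0Ω : (0 : (TangentSpace m).sub (N m)) ∈ Ω := by
    change ρ m 0 0 < ε
    rwa [(hρ m).self]
  refine ⟨ε, hε, fun v hv hvε => (hΩmem ⟨v, hv⟩ hvε).2.1, ?_⟩
  have hset : {x : M | ∃ v ∈ N m, ρ m v 0 < ε ∧ η (TangentBundle.mk m v) = x} =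
      (fun v => Ψ (x₁, v)) '' Ω := by
    ext x
    constructor
    · rintro ⟨v, hv, hvε, rfl⟩
      exact ⟨⟨v, hv⟩, hvε, hΨ1 _ (hΩmem ⟨v, hv⟩ hvε).2.1⟩
    · rintro ⟨v, hv, rfl⟩
      exact ⟨v.val, v.2, hv, (hΨ1 v (hΩmem v hv).2.1).symm⟩
  rw [hset]
  refine isLinearSlice_of_tube (hproper.isCompact_stabilizer m) hprincipal
    (hΨd.restrict_image (hW.prod hΩo) fun q hq => hWΩ ⟨hq.1, (hΩmem q.2 hq.2).1⟩) hΩo h0Ω hxW hΨ0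
    τ hτ (fun h v hv => (hτρ h v).trans_lt hv) ?_ h1U'
    ⟨hξW.isOpen_source, hχ.smoothOn.mono inter_subset_left, fun q hq => hχ.mk_eq q hq.1⟩ hξW rfl
    ?_ ?_
  · intro h v hv
    have hv' : τ h v ∈ Ω := (hτρ h v).trans_lt hv
    rw [hΨ1 v (hΩmem v hv).2.1, hΨ1 _ (hΩmem _ hv').2.1, ← hηequiv _ _ (hΩmem v hv).2.1]
    exact congrArg η (hτmap h v).symm
  · intro q hq v hv
    have hvU := (hΩmem v hv).2.1
    rw [hΨ1 v hvU, hΨη _ (hWW₀ hq.2) v hvU, hξ'.1 hq.1]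
  · intro g v hv w hw hgvw
    -- It suffices that `g • m` is within `δ` of `m`. This is the triangle inequality through `Ψ
    -- (x₁, w) = g • Ψ (x₁, v)`, with invariance of `d`.
    refine hVU g (hδV _ ?_)
    have h1 := hd.triangle m (Ψ (x₁, w)) (g • m)
    have h2 : d (Ψ (x₁, w)) (g • m) = d m (Ψ (x₁, v)) := by
      rw [← hgvw, hdinv, hd.comm]
    have h3 := (hΩmem v hv).2.2
    have h4 := (hΩmem w hw).2.2
    linarith
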